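/- Let $X$ be a smooth, projective, geometrically irreducible curve over the finite field $\mathbb{F}_q$, with function field $K$, and let $\infty\in X(\mathbb{F}_q)$ be a rational point. Let $A=\mathcal{O}_X(X\setminus\{\infty\})$ be the ring of functions regular away from $\infty$, let $\deg a$ be the opposite of the normalized valuation at $\infty$ of $a\in A\setminus\{0\}$, let $K_\infty$ be the completion of $K$ with respect to the absolute value with $\|a\|=q^{\deg a}$, and let $\mathbb{C}_\infty$ be the completion of an algebraic closure of $K_\infty$. Let $\tau\colon x\mapsto x^q$ on $\mathbb{C}_\infty$, and let $\phi\colon A\to\mathbb{C}_\infty[\tau]\subseteq\mathrm{End}_{\mathbb{F}_q}(\mathbb{C}_\infty)$ be a Drinfeld module of rank $1$ (for instance a Drinfeld–Hayes module, i.e. a normalized one): a ring homomorphism such that for every $a\neq 0$ the operator $\phi_a$ has degree $\deg a$ in $\tau$ and constant term $a$. Let $\mathbb{C}_\infty\hat\otimes A$ be the completion of the ring $\mathbb{C}_\infty\otimes_{\mathbb{F}_q}A$ for the sup norm $\|\sum_i c_i\otimes a_i\|=\sup_i\|c_i\|$ (where $(a_i)_i$ is any $\mathbb{F}_q$-basis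 of $A$; the norm does not depend on it), and let $$Sf_\phi(A)=\{\omega\in\mathbb{C}_\infty\hat\otimes A \;:\; \phi_a(\omega)=(1\otimes a)\,\omega\ \text{ for all } a\in A\}$$ be the $A$-module of special functions of $\phi$, where $\phi_a$ acts by $\sum_i c_i\otimes a_i\mapsto\sum_i\phi_a(c_i)\otimes a_i$ and $a\in A$ acts as multiplication by $1\otimes a$. Suppose that $Sf_\phi(A)\cong A$ as $A$-modules. Then there is an $\omega\in Sf_\phi(A)$ that is invertible in the ring $\mathbb{C}_\infty\hat\otimes A$. Moreover $\omega$ can be chosen such that, for every $\mathbb{F}_q$-basis $(a_i)_{i\ge 0}$ of $A$ with strictly increasing degrees, the coefficients $c_i\in\mathbb{C}_\infty$ in $\omega=\sum_i c_i\otimes a_i$ have strictly decreasing norms $\|c_i\|$. -/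

import Mathlib

open scoped TensorProduct WithZero NNReal

set_option linter.unusedSectionVars false

noncomputable section

namespace SpecialFunctions

/-! ### The completed tensor product `C ⊗̂ M` -/

/-- The completion of an ultrametric normed group is ultrametric. -/
theorem isUltrametricDist_completion (E : Type*) [SeminormedAddCommGroup E]
    [IsUltrametricDist E] : IsUltrametricDist (UniformSpace.Completion E) := by
  refine IsUltrametricDist.isUltrametricDist_of_forall_norm_add_le_max_norm fun x y => ?_
  induction x, y using UniformSpace.Completion.induction_on₂ with
  | hp => exact isClosed_le (by fun_prop) (by fun_prop)
  | ih a b =>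
    rw [← UniformSpace.Completion.coe_add]
    simpa using IsUltrametricDist.norm_add_le_max a b

section Tensor

variable (F C A : Type*) [Field F] [Finite F] [NormedField C] [IsUltrametricDist C]
  [Algebra F C] [CommRing A] [Algebra F A]

/-- `C ⊗ A` over `F`, as a type of its own, in order to carry the sup norm. -/
def Tensor : Type _ := C ⊗[F] A

instance : CommRing (Tensor F C A) := inferInstanceAs (CommRing (C ⊗[F] A))

instance : Algebra F (Tensor F C A) := inferInstanceAs (Algebra F (C ⊗[F] A))

variable {F C A}

/-- The pure tensor `c ⊗ a`. -/
def tmul (F : Type*) {C A : Type*} [Field F] [NormedField C] [Algebra F C] [CommRing A]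
    [Algebra F A] (c : C) (a : A) : Tensor F C A := (c ⊗ₜ[F] a : C ⊗[F] A)

theorem tensor_induction {motive : Tensor F C A → Prop} (x : Tensor F C A) (zero : motive 0)
    (tmul : ∀ c a, motive (tmul F c a)) (add : ∀ x y, motive x → motive y → motive (x + y)) :
    motive x :=
  TensorProduct.induction_on (motive := motive) x zero tmul add

/-- The contraction `C ⊗ A → C`, `c ⊗ a ↦ χ(a) c`, by a linear form `χ` on `A`. For the `i`-th
coordinate form of a basis `(aᵢ)` of `A` it maps `∑ cᵢ ⊗ aᵢ` to `cᵢ`. -/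
def contract (χ : Module.Dual F A) : Tensor F C A →ₗ[F] C :=
  (TensorProduct.rid F C).toLinearMap ∘ₗ LinearMap.lTensor C χ

/-- The sup norm on `C ⊗ A`: the supremum of the norms of all contractions. It is the supremum of
the norms of the coordinates with respect to any basis of `A`, see `norm_eq_iSup_coord`. -/
instance : Norm (Tensor F C A) := ⟨fun x => ⨆ χ : Module.Dual F A, ‖contract χ x‖⟩

theorem norm_def (x : Tensor F C A) : ‖x‖ = ⨆ χ : Module.Dual F A, ‖contract χ x‖ := rfl

theorem contract_tmul (χ : Module.Dual F A) (c : C) (a : A) :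
    contract χ (tmul F c a) = χ a • c :=
  (congrArg (TensorProduct.rid F C) (LinearMap.lTensor_tmul C χ c a)).trans
    (TensorProduct.rid_tmul c (χ a))

theorem norm_algebraMap_le_one (r : F) : ‖algebraMap F C r‖ ≤ 1 := by
  rcases eq_or_ne r 0 with rfl | hr
  · simp
  · have : IsOfFinOrder (Units.mk0 r hr) := isOfFinOrder_of_finite _
    obtain ⟨n, hn, h⟩ := isOfFinOrder_iff_pow_eq_one.mp this
    have h' : r ^ n = 1 := by simpa using congrArg Units.val h
    have h2 : ‖algebraMap F C r‖ ^ n = 1 := by rw [← norm_pow, ← map_pow, h']; simp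
    exact ((pow_eq_one_iff_of_nonneg (norm_nonneg _) hn.ne').mp h2).le

theorem norm_smul_le' (r : F) (c : C) : ‖r • c‖ ≤ ‖c‖ := by
  rw [Algebra.smul_def, norm_mul]
  exact mul_le_of_le_one_left (norm_nonneg _) (norm_algebraMap_le_one r)

theorem bddAbove_contract (x : Tensor F C A) :
    BddAbove (Set.range fun χ : Module.Dual F A => ‖contract χ x‖) := by
  suffices h : ∃ B, ∀ χ : Module.Dual F A, ‖contract χ x‖ ≤ B by
    obtain ⟨B, hB⟩ := h
    exact ⟨B, by rintro _ ⟨χ, rfl⟩; exact hB χ⟩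
  induction x using tensor_induction with
  | zero => exact ⟨0, fun χ => by rw [map_zero, norm_zero]⟩
  | tmul c a => exact ⟨‖c‖, fun χ => by rw [contract_tmul]; exact norm_smul_le' _ _⟩
  | add x y hx hy =>
    obtain ⟨B, hB⟩ := hx
    obtain ⟨B', hB'⟩ := hy
    refine ⟨B + B', fun χ => ?_⟩
    rw [map_add]
    exact (norm_add_le _ _).trans (add_le_add (hB χ) (hB' χ))

theorem norm_contract_le (χ : Module.Dual F A) (x : Tensor F C A) : ‖contract χ x‖ ≤ ‖x‖ :=
  le_ciSup (bddAbove_contract x) χ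

theorem tensor_norm_nonneg (x : Tensor F C A) : 0 ≤ ‖x‖ :=
  (norm_nonneg _).trans (norm_contract_le 0 x)

theorem tensor_norm_le {x : Tensor F C A} {B : ℝ}
    (h : ∀ χ : Module.Dual F A, ‖contract χ x‖ ≤ B) : ‖x‖ ≤ B := ciSup_le h

theorem tensor_norm_add_le_max (x y : Tensor F C A) : ‖x + y‖ ≤ max ‖x‖ ‖y‖ := by
  refine tensor_norm_le fun χ => ?_
  rw [map_add]
  exact (IsUltrametricDist.norm_add_le_max _ _).trans
    (max_le_max (norm_contract_le χ x) (norm_contract_le χ y))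

theorem tensor_norm_tmul_le (c : C) (a : A) : ‖tmul F c a‖ ≤ ‖c‖ :=
  tensor_norm_le fun χ => by rw [contract_tmul]; exact norm_smul_le' _ _

theorem tensor_norm_sum_le {ι : Type*} (s : Finset ι) (f : ι → Tensor F C A) {B : ℝ}
    (hB : 0 ≤ B) (h : ∀ i ∈ s, ‖f i‖ ≤ B) : ‖∑ i ∈ s, f i‖ ≤ B := by
  induction s using Finset.cons_induction with
  | empty =>
    refine tensor_norm_le fun χ => ?_
    rw [Finset.sum_empty, map_zero, norm_zero]; exact hB
  | cons i s hi ih =>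
    rw [Finset.sum_cons]
    exact (tensor_norm_add_le_max _ _).trans (max_le (h i (Finset.mem_cons_self i s))
      (ih fun j hj => h j (Finset.mem_cons_of_mem hj)))

/-- Expansion of an element of `C ⊗ A` along a basis of `A`. -/
theorem exists_expansion {ι : Type*} (b : Module.Basis ι F A) (x : Tensor F C A) :
    ∃ s : Finset ι, x = ∑ i ∈ s, tmul F (contract (b.coord i) x) (b i) := by
  classical
  obtain ⟨m, hm⟩ := (TensorProduct.equivFinsuppOfBasisRight b).symm.surjective x
  have hx : x = ∑ i ∈ m.support, tmul F (m i) (b i) :=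
    hm.symm.trans (TensorProduct.equivFinsuppOfBasisRight_symm_apply b m)
  refine ⟨m.support, ?_⟩
  have key : ∀ i ∈ m.support, contract (b.coord i) x = m i := by
    intro i hi
    rw [hx, map_sum, Finset.sum_eq_single i]
    · rw [contract_tmul]; simp
    · intro j _ hj
      rw [contract_tmul]; simp [Finsupp.single_eq_of_ne' hj]
    · intro h; exact absurd hi h
  nth_rw 1 [hx]
  exact Finset.sum_congr rfl fun i hi => by rw [key i hi]

theorem norm_eq_iSup_coord {ι : Type*} (b : Module.Basis ι F A) (x : Tensor F C A) :
    ‖x‖ = ⨆ i, ‖contract (b.coord i) x‖ := by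
  have hb : BddAbove (Set.range fun i => ‖contract (b.coord i) x‖) :=
    (bddAbove_contract x).mono (by rintro _ ⟨i, rfl⟩; exact ⟨b.coord i, rfl⟩)
  refine le_antisymm ?_ (Real.iSup_le (fun i => norm_contract_le _ x) (tensor_norm_nonneg x))
  obtain ⟨s, hs⟩ := exists_expansion b x
  nth_rw 1 [hs]
  exact tensor_norm_sum_le s _ (Real.iSup_nonneg fun i => norm_nonneg _) fun i _ =>
    (tensor_norm_tmul_le _ _).trans (le_ciSup hb i)

theorem tensor_norm_mul_le (x y : Tensor F C A) : ‖x * y‖ ≤ ‖x‖ * ‖y‖ := by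
  let b := Module.Free.chooseBasis F A
  obtain ⟨s, hs⟩ := exists_expansion b x
  obtain ⟨t, ht⟩ := exists_expansion b y
  have h0 : 0 ≤ ‖x‖ * ‖y‖ := mul_nonneg (tensor_norm_nonneg x) (tensor_norm_nonneg y)
  have h : x * y = ∑ i ∈ s, ∑ j ∈ t,
      tmul F (contract (b.coord i) x * contract (b.coord j) y) (b i * b j) := by
    conv_lhs => rw [hs, ht, Finset.sum_mul_sum]
    refine Finset.sum_congr rfl fun i _ => Finset.sum_congr rfl fun j _ => ?_
    exact Algebra.TensorProduct.tmul_mul_tmul _ _ _ _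
  rw [h]
  refine tensor_norm_sum_le _ _ h0 fun i _ => tensor_norm_sum_le _ _ h0 fun j _ => ?_
  refine (tensor_norm_tmul_le _ _).trans ?_
  rw [norm_mul]
  exact mul_le_mul (norm_contract_le _ _) (norm_contract_le _ _) (norm_nonneg _)
    (tensor_norm_nonneg x)

theorem eq_zero_of_tensor_norm (x : Tensor F C A) (h : ‖x‖ = 0) : x = 0 := by
  let b := Module.Free.chooseBasis F A
  obtain ⟨s, hs⟩ := exists_expansion b x
  rw [hs]
  refine Finset.sum_eq_zero fun i _ => ?_
  have : contract (b.coord i) x = 0 :=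
    norm_le_zero_iff.mp ((norm_contract_le _ x).trans h.le)
  rw [this]
  exact TensorProduct.zero_tmul _ _

variable (F C A) in
/-- The sup norm as a ring norm. -/
def tensorRingNorm : RingNorm (Tensor F C A) where
  toFun x := ‖x‖
  map_zero' := le_antisymm (tensor_norm_le fun χ => by simp) (tensor_norm_nonneg _)
  add_le' x y := (tensor_norm_add_le_max x y).trans
    (max_le_add_of_nonneg (tensor_norm_nonneg x) (tensor_norm_nonneg y))
  neg' x := by simp only [norm_def, map_neg, norm_neg]
  mul_le' := tensor_norm_mul_le
  eq_zero_of_map_eq_zero' := eq_zero_of_tensor_norm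

instance : NormedCommRing (Tensor F C A) :=
  { (tensorRingNorm F C A).toNormedRing with mul_comm := mul_comm }

variable (F C A) in
/-- The ring `C ⊗̂ A`, the completion of `C ⊗ A` for the sup norm. -/
def CompletedTensor : Type _ := UniformSpace.Completion (Tensor F C A)

instance : NormedCommRing (CompletedTensor F C A) :=
  inferInstanceAs (NormedCommRing (UniformSpace.Completion (Tensor F C A)))

instance : CompleteSpace (CompletedTensor F C A) :=
  inferInstanceAs (CompleteSpace (UniformSpace.Completion (Tensor F C A)))

variable (F C A) in
/-- The inclusion `C ⊗ A → C ⊗̂ A`. -/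
def toCompleted : Tensor F C A →+* CompletedTensor F C A :=
  (UniformSpace.Completion.coeRingHom : Tensor F C A →+* UniformSpace.Completion (Tensor F C A))

/-- `A` acts on `C ⊗̂ A` through the right factor, `a` acting as multiplication by `1 ⊗ a`. -/
instance : Algebra A (CompletedTensor F C A) :=
  ((toCompleted F C A).comp
    (Algebra.TensorProduct.includeRight : A →ₐ[F] C ⊗[F] A).toRingHom).toAlgebra

/-- `f ⊗ id` on `C ⊗ A`, for an `F`-linear map `f : C → C`. -/
def mapLeft (f : Module.End F C) : Tensor F C A →ₗ[F] Tensor F C A :=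
  LinearMap.rTensor A f

theorem contract_mapLeft (f : Module.End F C) (χ : Module.Dual F A) (x : Tensor F C A) :
    contract χ (mapLeft f x) = f (contract χ x) := by
  induction x using tensor_induction with
  | zero => rw [map_zero, map_zero, map_zero]
  | tmul c a =>
    rw [contract_tmul, map_smul]
    exact contract_tmul χ (f c) a
  | add x y hx hy => rw [map_add, map_add, map_add, hx, hy, map_add]

theorem uniformContinuous_mapLeft (f : Module.End F C) (hf : Continuous f) :
    UniformContinuous (mapLeft f : Tensor F C A → Tensor F C A) := by
  refine uniformContinuous_of_continuousAt_zero (mapLeft f : Tensor F C A →ₗ[F] Tensor F C A) ?_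
  rw [Metric.continuousAt_iff]
  intro ε hε
  obtain ⟨δ, hδ, h⟩ := Metric.continuousAt_iff.mp (hf.continuousAt (x := 0)) (ε / 2) (half_pos hε)
  refine ⟨δ, hδ, fun {x} hx => ?_⟩
  rw [map_zero, dist_zero_right] at *
  refine lt_of_le_of_lt (tensor_norm_le fun χ => ?_) (half_lt_self hε)
  rw [contract_mapLeft]
  have := h (x := contract χ x) (by
    rw [dist_zero_right]; exact (norm_contract_le χ x).trans_lt hx)
  rw [dist_zero_right] at this
  exact this.le

/-- The extension of `f ⊗ id` to `C ⊗̂ A`, for a continuous `F`-linear map `f : C → C`; it maps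
`∑ cᵢ ⊗ aᵢ` to `∑ f(cᵢ) ⊗ aᵢ`. -/
def completedMapLeft (f : Module.End F C) (hf : Continuous f) :
    CompletedTensor F C A →+ CompletedTensor F C A :=
  AddMonoidHom.completion (mapLeft f : Tensor F C A →ₗ[F] Tensor F C A).toAddMonoidHom
    (uniformContinuous_mapLeft f hf).continuous

theorem completedMapLeft_coe (f : Module.End F C) (hf : Continuous f) (x : Tensor F C A) :
    completedMapLeft f hf (toCompleted F C A x) = toCompleted F C A (mapLeft f x) :=
  UniformSpace.Completion.map_coe (uniformContinuous_mapLeft f hf) x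

theorem mapLeft_mul_tmul (f : Module.End F C) (a : A) (x : Tensor F C A) :
    mapLeft f (tmul F 1 a * x) = tmul F 1 a * mapLeft f x := by
  induction x using tensor_induction with
  | zero => rw [map_zero, mul_zero, map_zero]
  | tmul c b =>
    have h : ∀ d : C, tmul F 1 a * tmul F d b = tmul F d (a * b) := fun d =>
      (Algebra.TensorProduct.tmul_mul_tmul 1 d a b).trans (by rw [one_mul]; rfl)
    have h' : ∀ (d : C) (e : A), mapLeft f (tmul F d e) = tmul F (f d) e := fun d e =>
      LinearMap.rTensor_tmul A f e d
    rw [h, h', h', h]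
  | add x y hx hy => rw [mul_add, map_add, map_add, mul_add, hx, hy]

theorem completedMapLeft_smul (f : Module.End F C) (hf : Continuous f) (a : A)
    (ω : CompletedTensor F C A) :
    completedMapLeft f hf (a • ω) = a • completedMapLeft f hf ω := by
  have hc : Continuous (completedMapLeft f hf : CompletedTensor F C A → CompletedTensor F C A) :=
    UniformSpace.Completion.continuous_map
  have hs : ∀ ω : CompletedTensor F C A, a • ω = toCompleted F C A (tmul F 1 a) * ω :=
    fun ω => Algebra.smul_def a ω
  refine UniformSpace.Completion.induction_on
    (p := fun ω : CompletedTensor F C A =>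
      completedMapLeft f hf (a • ω) = a • completedMapLeft f hf ω) ω ?_ fun x => ?_
  · simp only [hs]
    exact isClosed_eq (hc.comp (continuous_const.mul continuous_id)) (continuous_const.mul hc)
  · change completedMapLeft f hf (a • toCompleted F C A x) =
      a • completedMapLeft f hf (toCompleted F C A x)
    rw [hs, hs, ← map_mul, completedMapLeft_coe, completedMapLeft_coe, mapLeft_mul_tmul, map_mul]

/-- The extension of the contraction by `χ` to `C ⊗̂ A` (for complete `C`). Letting `χ` vary, it
identifies `C ⊗̂ A` with the continuous linear maps from the dual of `A` to `C`. -/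
def completedContract (χ : Module.Dual F A) : CompletedTensor F C A → C :=
  UniformSpace.Completion.extension (contract χ : Tensor F C A → C)

theorem uniformContinuous_contract (χ : Module.Dual F A) :
    UniformContinuous (contract χ : Tensor F C A → C) :=
  (AddMonoidHomClass.lipschitz_of_bound (contract χ : Tensor F C A →ₗ[F] C) 1
    (fun x => by rw [one_mul]; exact norm_contract_le χ x)).uniformContinuous

end Tensor

/-! ### Curves with a rational point, in terms of their function fields -/

/-- `K` is the function field of a smooth projective geometrically irreducible curve over the
finite (hence perfect) field `F`: it is a finite extension of some `F(t)` with `t` transcendental,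
and `F` is algebraically closed in `K`. -/
class IsCurveFunctionField (F K : Type*) [Field F] [Field K] [Algebra F K] : Prop where
  exists_finite : ∃ t : K, Transcendental F t ∧
    FiniteDimensional (IntermediateField.adjoin F {t}) K
  mem_range_of_isAlgebraic : ∀ x : K, IsAlgebraic F x → x ∈ (algebraMap F K).range

/-- A rational point `∞` of the curve with function field `K`, given by its normalized valuation
(written multiplicatively), whose residue field is `F`. -/
structure RationalPoint (F K : Type*) [Field F] [Field K] [Algebra F K] where
  /-- The normalized valuation at the point. -/
  val : Valuation K ℤᵐ⁰
  surjective : Function.Surjective val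
  residue : ∀ x : K, val x ≤ 1 → ∃ c : F, val (x - algebraMap F K c) < 1

variable {F K : Type*} [Field F] [Finite F] [Field K] [Algebra F K]

theorem isIntegral_algebraMap_int (r : F) : IsIntegral ℤ (algebraMap F K r) := by
  rcases eq_or_ne r 0 with rfl | hr
  · simpa using isIntegral_zero
  · have : IsOfFinOrder (Units.mk0 r hr) := isOfFinOrder_of_finite _
    obtain ⟨n, hn, h⟩ := isOfFinOrder_iff_pow_eq_one.mp this
    have h' : r ^ n = 1 := by simpa using congrArg Units.val h
    refine IsIntegral.of_pow hn ?_
    rw [← map_pow, h', map_one]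
    exact isIntegral_one

theorem algebraMap_mem_valuationSubring (O : ValuationSubring K) (r : F) :
    algebraMap F K r ∈ O := by
  have h : IsIntegral O (algebraMap F K r) := (isIntegral_algebraMap_int r).tower_top
  obtain ⟨y, hy⟩ := IsIntegrallyClosed.isIntegral_iff.mp h
  rw [← hy]
  exact y.2

namespace RationalPoint

variable (P : RationalPoint F K)

/-- The ring `A` of functions that are regular away from `∞`. The points of the curve other than
the generic one are the valuation subrings of `K` other than `K` (all of them contain `F`, and
including `K` itself does not change the intersection). -/
def A : Subalgebra F K where
  carrier := {x | ∀ O : ValuationSubring K, O ≠ P.val.valuationSubring → x ∈ O}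
  mul_mem' hx hy O hO := mul_mem (hx O hO) (hy O hO)
  add_mem' hx hy O hO := add_mem (hx O hO) (hy O hO)
  algebraMap_mem' r O _ := algebraMap_mem_valuationSubring O r

/-- The degree of a nonzero `a`, the opposite of its (additive) valuation at `∞`. -/
def deg (a : P.A) : ℤ := WithZero.log (P.val (a : K))

theorem one_lt_card : 1 < (Nat.card F : ℝ≥0) := by
  exact_mod_cast Finite.one_lt_card (α := F)

/-- The `∞`-adic absolute value, `‖a‖ = q ^ deg a`. -/
def abv : AbsoluteValue K ℝ where
  toFun x := WithZeroMulInt.toNNReal (one_lt_card (F := F)).ne_zero (P.val x)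
  map_mul' x y := by simp
  nonneg' x := NNReal.coe_nonneg _
  eq_zero' x := by simp
  add_le' x y := by
    have hm := (WithZeroMulInt.toNNReal_strictMono (one_lt_card (F := F))).monotone
    have h := hm (P.val.map_add x y)
    rw [hm.map_max] at h
    exact_mod_cast h.trans (max_le_add_of_nonneg zero_le zero_le)

theorem abv_add_le_max (x y : K) : P.abv (x + y) ≤ max (P.abv x) (P.abv y) := by
  have hm := (WithZeroMulInt.toNNReal_strictMono (one_lt_card (F := F))).monotone
  have h := hm (P.val.map_add x y)
  rw [hm.map_max] at h
  exact_mod_cast h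

instance : IsUltrametricDist (WithAbs P.abv) :=
  IsUltrametricDist.isUltrametricDist_of_forall_norm_add_le_max_norm fun x y =>
    P.abv_add_le_max x.ofAbs y.ofAbs

/-- `K∞`, the completion of `K` at `∞`. -/
abbrev Kinf : Type _ := P.abv.Completion

instance : IsUltrametricDist P.Kinf := isUltrametricDist_completion _

instance : NontriviallyNormedField P.Kinf where
  non_trivial := by
    obtain ⟨x, hx⟩ := P.surjective (WithZero.exp (1 : ℤ))
    refine ⟨((WithAbs.toAbs P.abv x : WithAbs P.abv) : P.Kinf), ?_⟩
    rw [UniformSpace.Completion.norm_coe]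
    change 1 < P.abv x
    have hm := WithZeroMulInt.toNNReal_strictMono (one_lt_card (F := F))
    have h1 : (1 : ℤᵐ⁰) < P.val x := by
      rw [hx, ← WithZero.exp_zero]
      exact WithZero.exp_lt_exp.mpr one_pos
    have h := hm h1
    rw [map_one] at h
    exact_mod_cast h

/-- An algebraic closure of `K∞`. -/
def KinfAlgCl : Type _ := AlgebraicClosure P.Kinf

instance : Field P.KinfAlgCl := inferInstanceAs (Field (AlgebraicClosure P.Kinf))

instance : Algebra P.Kinf P.KinfAlgCl :=
  inferInstanceAs (Algebra P.Kinf (AlgebraicClosure P.Kinf))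

instance : IsAlgClosure P.Kinf P.KinfAlgCl :=
  inferInstanceAs (IsAlgClosure P.Kinf (AlgebraicClosure P.Kinf))

instance : Algebra.IsAlgebraic P.Kinf P.KinfAlgCl := IsAlgClosure.isAlgebraic

/-- The unique extension of the absolute value of `K∞`. -/
instance : NormedField P.KinfAlgCl := spectralNorm.normedField P.Kinf P.KinfAlgCl

instance : IsUltrametricDist P.KinfAlgCl :=
  IsUltrametricDist.isUltrametricDist_of_forall_norm_add_le_max_norm
    (isNonarchimedean_spectralNorm (K := P.Kinf) (L := P.KinfAlgCl))

/-- `C∞`, the completion of the algebraic closure of `K∞`. -/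
def Cinf : Type _ := UniformSpace.Completion P.KinfAlgCl

instance : NormedField P.Cinf := inferInstanceAs (NormedField (UniformSpace.Completion _))

instance : CompleteSpace P.Cinf := inferInstanceAs (CompleteSpace (UniformSpace.Completion _))

instance : IsUltrametricDist P.Cinf := isUltrametricDist_completion _

/-- The inclusion of `K` into `C∞`. -/
def toCinf : K →+* P.Cinf :=
  ((UniformSpace.Completion.coeRingHom : P.KinfAlgCl →+* UniformSpace.Completion P.KinfAlgCl).comp
    (algebraMap P.Kinf P.KinfAlgCl)).comp
      ((UniformSpace.Completion.coeRingHom : WithAbs P.abv →+* P.Kinf).comp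
        (WithAbs.equiv P.abv).symm.toRingHom)

instance : Algebra F P.Cinf := (P.toCinf.comp (algebraMap F K)).toAlgebra

end RationalPoint

/-! ### Drinfeld modules and special functions -/

/-- A Drinfeld module of rank `r`: a ring homomorphism `φ` from `A` to the endomorphisms of the
`F`-vector space `C∞` such that, for `a ≠ 0`, `φ_a` is a polynomial `∑ pᵢ τⁱ` in the Frobenius
endomorphism `τ(x) = x ^ q`, of degree `r · deg a` in `τ` and with constant term `a`. -/
structure DrinfeldModule (P : RationalPoint F K) (r : ℕ) where
  /-- The underlying ring homomorphism. -/
  hom : P.A →+* Module.End F P.Cinf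
  exists_poly : ∀ a : P.A, a ≠ 0 → ∃ p : Polynomial P.Cinf,
    (p.natDegree : ℤ) = r * P.deg a ∧ p.coeff 0 = P.toCinf a ∧
      ∀ x : P.Cinf, hom a x = ∑ i ∈ Finset.range (p.natDegree + 1), p.coeff i * x ^ Nat.card F ^ i

namespace DrinfeldModule

variable {P : RationalPoint F K} {r : ℕ} (φ : DrinfeldModule P r)

theorem continuous_hom (a : P.A) : Continuous (φ.hom a) := by
  rcases eq_or_ne a 0 with rfl | ha
  · rw [map_zero]; exact continuous_zero
  · obtain ⟨p, -, -, hp⟩ := φ.exists_poly a ha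
    have : (φ.hom a : P.Cinf → P.Cinf) = fun x =>
        ∑ i ∈ Finset.range (p.natDegree + 1), p.coeff i * x ^ Nat.card F ^ i := funext hp
    rw [this]
    fun_prop

/-- The `A`-module `Sf_φ(A)` of special functions: the `ω` in `C∞ ⊗̂ A` with
`φ_a(ω) = (1 ⊗ a) ω` for all `a` in `A`. -/
def specialFunctions : Submodule P.A (CompletedTensor F P.Cinf P.A) where
  carrier := {ω | ∀ a : P.A, completedMapLeft (φ.hom a) (φ.continuous_hom a) ω = a • ω}
  add_mem' hx hy a := by rw [map_add, hx a, hy a, smul_add]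
  zero_mem' a := by rw [map_zero, smul_zero]
  smul_mem' b ω hω a := by rw [completedMapLeft_smul, hω a, smul_comm]

end DrinfeldModule

end SpecialFunctions

end

open scoped TensorProduct WithZero NNReal

set_option linter.unusedSectionVars false

noncomputable section

namespace SpecialFunctions

/-! ### Elements of the completed tensor product as continuous maps on the dual of `A` -/

section Contraction

variable {F C A : Type*} [Field F] [Finite F] [NormedField C] [IsUltrametricDist C]
  [CompleteSpace C] [Algebra F C] [CommRing A] [Algebra F A]

/-! An element `ω` of the completed tensor product is the same as the map `dualEval ω` from the dual
`A*` to `C∞` sending `χ` to `(id ⊗ χ)(ω)`, which is continuous for the weak topology. As `F` is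
finite, `A*` is compact. Being a special function means being equivariant: `χ ∘ a` goes to `φ_a` of
the image of `χ` (`mem_specialFunctions_iff`).

A generator `ω` of a free module of special functions is injective on `A*`
(`injective_of_generator`). Its kernel is a closed submodule, hence the annihilator of an ideal `I`.
If `I` were proper, then, `A` being Dedekind, some `s/t` outside `A` would satisfy `(s/t)I ⊆ A`; so
`sω` would vanish on the `t`-torsion and equal `tη` for a special function `η = aω`, forcing `s =
ta`.

Given injectivity, let `N(v) = minNorm ω v` be the least norm of `ω` on forms with `χ(v) ≠ 0`. In
rank one, the `a`-torsion of `A*` provides all `q ^ deg a` roots of `φ_a`. Factoring `φ_a` over them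
gives `N(v) = Φ(N(av))` with `Φ` strictly increasing and independent of `v`, so multiplication by
`a` preserves the order defined by `N` (`minNorm_mul_lt_iff`). Moreover `N` satisfies `N(v + w) ≥
min (N v) (N w)` and has finite superlevel sets, so it behaves like the inverse of an absolute value
on `K` unbounded on `A`. The only place where functions in `A` may have poles is `∞`, so `N` is
strictly decreasing in the degree (`lt_of_deg_lt`).

By duality, a form killing all functions of degree less than `deg w` has image of norm at most
`N(w)` (`norm_dualEval_le_minNorm`). The `i`-th coordinate form of a basis with increasing degrees
is such a form for `w = b i`, and it is nonzero at `b i`, so `‖cᵢ‖ = N(b i)` decreases strictly.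
Likewise the part of `ω` along the constants dominates the rest, and a geometric series inverts `ω`.
-/

theorem completedTensor_induction {motive : CompletedTensor F C A → Prop}
    (ω : CompletedTensor F C A) (closed : IsClosed {ω | motive ω})
    (coe : ∀ x : Tensor F C A, motive (toCompleted F C A x)) : motive ω :=
  UniformSpace.Completion.induction_on (p := motive) ω closed coe

theorem norm_toCompleted (x : Tensor F C A) : ‖toCompleted F C A x‖ = ‖x‖ :=
  UniformSpace.Completion.norm_coe x

theorem continuous_completedContract (χ : Module.Dual F A) :
    Continuous (completedContract χ : CompletedTensor F C A → C) :=
  UniformSpace.Completion.continuous_extension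

theorem completedContract_coe (χ : Module.Dual F A) (x : Tensor F C A) :
    completedContract χ (toCompleted F C A x) = contract χ x :=
  UniformSpace.Completion.extension_coe (uniformContinuous_contract χ) x

theorem completedContract_add (χ : Module.Dual F A) (ω η : CompletedTensor F C A) :
    completedContract χ (ω + η) = completedContract χ ω + completedContract χ η := by
  have hc := continuous_completedContract (C := C) χ
  induction ω using completedTensor_induction with
  | closed => exact isClosed_eq (by fun_prop) (by fun_prop)
  | coe x =>
    induction η using completedTensor_induction with
    | closed => exact isClosed_eq (by fun_prop) (by fun_prop)
    | coe y =>
      rw [← map_add, completedContract_coe, completedContract_coe, completedContract_coe, map_add]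

theorem completedContract_zero (χ : Module.Dual F A) :
    completedContract χ (0 : CompletedTensor F C A) = 0 := by
  rw [← map_zero (toCompleted F C A), completedContract_coe, map_zero]

theorem completedContract_sub (χ : Module.Dual F A) (ω η : CompletedTensor F C A) :
    completedContract χ (ω - η) = completedContract χ ω - completedContract χ η := by
  rw [eq_sub_iff_add_eq, ← completedContract_add, sub_add_cancel]

theorem contract_add_left (χ ψ : Module.Dual F A) (x : Tensor F C A) :
    contract (χ + ψ) x = contract χ x + contract ψ x := by
  induction x using tensor_induction with
  | zero => simp only [map_zero, add_zero]
  | tmul c a => simp only [contract_tmul, LinearMap.add_apply, add_smul]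
  | add x y hx hy => rw [map_add, map_add, map_add, hx, hy]; abel

theorem contract_smul_left (r : F) (χ : Module.Dual F A) (x : Tensor F C A) :
    contract (r • χ) x = r • contract χ x := by
  induction x using tensor_induction with
  | zero => simp only [map_zero, smul_zero]
  | tmul c a => simp only [contract_tmul, LinearMap.smul_apply, smul_eq_mul, mul_smul]
  | add x y hx hy => rw [map_add, map_add, hx, hy, smul_add]

/-- An element `ω` of `C ⊗̂ A` as a linear map from the dual of `A` to `C`. -/
def dualEval (ω : CompletedTensor F C A) : Module.Dual F A →ₗ[F] C where
  toFun χ := completedContract χ ω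
  map_add' χ ψ := by
    have hc := fun χ => continuous_completedContract (F := F) (A := A) (C := C) χ
    induction ω using completedTensor_induction with
    | closed => exact isClosed_eq (hc _) ((hc _).add (hc _))
    | coe x => simp only [completedContract_coe, contract_add_left]
  map_smul' r χ := by
    have hc := fun χ => continuous_completedContract (F := F) (A := A) (C := C) χ
    induction ω using completedTensor_induction with
    | closed =>
      simp only [Algebra.smul_def]
      exact isClosed_eq (hc _) (continuous_const.mul (hc _))
    | coe x => simp only [completedContract_coe, contract_smul_left, RingHom.id_apply]

theorem dualEval_apply (ω : CompletedTensor F C A) (χ : Module.Dual F A) :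
    dualEval ω χ = completedContract χ ω := rfl

theorem norm_completedContract_le (χ : Module.Dual F A) (ω : CompletedTensor F C A) :
    ‖completedContract χ ω‖ ≤ ‖ω‖ := by
  have hc := continuous_completedContract (C := C) χ
  induction ω using completedTensor_induction with
  | closed => exact isClosed_le (by fun_prop) (by fun_prop)
  | coe x => rw [completedContract_coe, norm_toCompleted]; exact norm_contract_le χ x

theorem exists_norm_sub_toCompleted_lt (ω : CompletedTensor F C A) {ε : ℝ} (hε : 0 < ε) :
    ∃ x : Tensor F C A, ‖ω - toCompleted F C A x‖ < ε := by
  have hd : DenseRange (toCompleted F C A) :=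
    UniformSpace.Completion.denseRange_coe (α := Tensor F C A)
  obtain ⟨x, hx⟩ := Metric.denseRange_iff.mp hd ω ε hε
  exact ⟨x, by rwa [dist_eq_norm] at hx⟩

/-- The formula for the sup norm survives completion, by approximation from `C ⊗ A`. Consequently an
element is determined by its contractions. -/
theorem norm_le_of_forall_completedContract {ω : CompletedTensor F C A} {B : ℝ}
    (h : ∀ χ : Module.Dual F A, ‖completedContract χ ω‖ ≤ B) : ‖ω‖ ≤ B := by
  refine le_of_forall_pos_le_add fun ε hε => ?_
  obtain ⟨x, hx⟩ := exists_norm_sub_toCompleted_lt ω (half_pos hε)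
  have hx' : ‖x‖ ≤ B + ε / 2 := tensor_norm_le fun χ => by
    have h1 : contract χ x =
        completedContract χ ω - completedContract χ (ω - toCompleted F C A x) := by
      rw [completedContract_sub, completedContract_coe]; abel
    rw [h1]
    exact (norm_sub_le _ _).trans
      (add_le_add (h χ) ((norm_completedContract_le χ _).trans hx.le))
  calc ‖ω‖ = ‖(ω - toCompleted F C A x) + toCompleted F C A x‖ := by rw [sub_add_cancel]
    _ ≤ ‖ω - toCompleted F C A x‖ + ‖toCompleted F C A x‖ := norm_add_le _ _
    _ ≤ B + ε := by rw [norm_toCompleted]; linarith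

theorem completedTensor_ext {ω η : CompletedTensor F C A}
    (h : ∀ χ : Module.Dual F A, completedContract χ ω = completedContract χ η) : ω = η := by
  rw [← sub_eq_zero, ← norm_le_zero_iff]
  refine norm_le_of_forall_completedContract fun χ => ?_
  rw [completedContract_sub, h, sub_self, norm_zero]

theorem continuous_completedMapLeft (f : Module.End F C) (hf : Continuous f) :
    Continuous (completedMapLeft f hf : CompletedTensor F C A → CompletedTensor F C A) :=
  UniformSpace.Completion.continuous_map

theorem completedContract_completedMapLeft (f : Module.End F C) (hf : Continuous f)
    (χ : Module.Dual F A) (ω : CompletedTensor F C A) :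
    completedContract χ (completedMapLeft f hf ω) = f (completedContract χ ω) := by
  have hc := continuous_completedContract (C := C) χ
  induction ω using completedTensor_induction with
  | closed =>
    exact isClosed_eq (hc.comp (continuous_completedMapLeft f hf)) (hf.comp hc)
  | coe x => simp only [completedMapLeft_coe, completedContract_coe, contract_mapLeft]

theorem tmul_mul_tmul (c d : C) (a b : A) :
    tmul F c a * tmul F d b = tmul F (c * d) (a * b) :=
  Algebra.TensorProduct.tmul_mul_tmul c d a b

theorem contract_one_tmul_mul (a : A) (χ : Module.Dual F A) (x : Tensor F C A) :
    contract χ (tmul F 1 a * x) = contract (χ ∘ₗ LinearMap.mulLeft F a) x := by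
  induction x using tensor_induction with
  | zero => rw [mul_zero, map_zero, map_zero]
  | tmul c b => rw [tmul_mul_tmul, contract_tmul, contract_tmul, one_mul]; rfl
  | add x y hx hy => rw [mul_add, map_add, map_add, hx, hy]

theorem smul_completedTensor_def (a : A) (ω : CompletedTensor F C A) :
    a • ω = toCompleted F C A (tmul F 1 a) * ω := Algebra.smul_def a ω

theorem completedContract_smul (a : A) (χ : Module.Dual F A) (ω : CompletedTensor F C A) :
    completedContract χ (a • ω) = completedContract (χ ∘ₗ LinearMap.mulLeft F a) ω := by
  have hc := fun χ => continuous_completedContract (F := F) (A := A) (C := C) χ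
  rw [smul_completedTensor_def]
  induction ω using completedTensor_induction with
  | closed => exact isClosed_eq ((hc _).comp (continuous_const.mul continuous_id)) (hc _)
  | coe x => rw [← map_mul, completedContract_coe, completedContract_coe, contract_one_tmul_mul]

/-- `id ⊗ π` on `C ⊗ A`, for an `F`-linear map `π : A → A`. -/
def mapRight (π : Module.End F A) : Tensor F C A →ₗ[F] Tensor F C A :=
  LinearMap.lTensor C π

theorem mapRight_tmul (π : Module.End F A) (c : C) (a : A) :
    mapRight π (tmul F c a) = tmul F c (π a) := LinearMap.lTensor_tmul C π c a

theorem contract_mapRight (π : Module.End F A) (χ : Module.Dual F A) (x : Tensor F C A) :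
    contract χ (mapRight π x) = contract (χ ∘ₗ π) x := by
  induction x using tensor_induction with
  | zero => simp only [map_zero]
  | tmul c a => rw [mapRight_tmul, contract_tmul, contract_tmul]; rfl
  | add x y hx hy => rw [map_add, map_add, map_add, hx, hy]

theorem uniformContinuous_mapRight (π : Module.End F A) :
    UniformContinuous (mapRight π : Tensor F C A → Tensor F C A) :=
  (AddMonoidHomClass.lipschitz_of_bound (mapRight π : Tensor F C A →ₗ[F] Tensor F C A) 1
    (fun x => by
      rw [one_mul]
      refine tensor_norm_le fun χ => ?_
      rw [contract_mapRight]
      exact norm_contract_le _ x)).uniformContinuous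

/-- The extension of `id ⊗ π` to `C ⊗̂ A`. -/
def completedMapRight (π : Module.End F A) : CompletedTensor F C A → CompletedTensor F C A :=
  UniformSpace.Completion.map (mapRight π : Tensor F C A → Tensor F C A)

theorem completedContract_completedMapRight (π : Module.End F A) (χ : Module.Dual F A)
    (ω : CompletedTensor F C A) :
    completedContract χ (completedMapRight π ω) = completedContract (χ ∘ₗ π) ω := by
  have hc := fun χ => continuous_completedContract (F := F) (A := A) (C := C) χ
  have hm : Continuous (completedMapRight π : CompletedTensor F C A → CompletedTensor F C A) :=
    UniformSpace.Completion.continuous_map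
  induction ω using completedTensor_induction with
  | closed => exact isClosed_eq ((hc _).comp hm) (hc _)
  | coe x =>
    have : completedMapRight π (toCompleted F C A x) = toCompleted F C A (mapRight π x) :=
      UniformSpace.Completion.map_coe (uniformContinuous_mapRight π) x
    rw [this, completedContract_coe, completedContract_coe, contract_mapRight]

theorem exists_finiteDimensional_contract_eq_zero (x : Tensor F C A) :
    ∃ W : Submodule F A, FiniteDimensional F W ∧
      ∀ χ : Module.Dual F A, (∀ v ∈ W, χ v = 0) → contract χ x = 0 := by
  induction x using tensor_induction with
  | zero => exact ⟨⊥, inferInstance, fun χ _ => map_zero _⟩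
  | tmul c a =>
    refine ⟨F ∙ a, inferInstance, fun χ h => ?_⟩
    rw [contract_tmul, h a (Submodule.mem_span_singleton_self a), zero_smul]
  | add x y hx hy =>
    obtain ⟨V, _, hV⟩ := hx
    obtain ⟨W, _, hW⟩ := hy
    refine ⟨V ⊔ W, inferInstance, fun χ h => ?_⟩
    rw [map_add, hV χ fun v hv => h v (Submodule.mem_sup_left hv),
      hW χ fun v hv => h v (Submodule.mem_sup_right hv), add_zero]

/-- Continuity of `dualEval ω` at `0` for the weak topology. -/
theorem exists_finiteDimensional_norm_dualEval_lt (ω : CompletedTensor F C A) {ε : ℝ}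
    (hε : 0 < ε) : ∃ W : Submodule F A, FiniteDimensional F W ∧
      ∀ χ : Module.Dual F A, (∀ v ∈ W, χ v = 0) → ‖dualEval ω χ‖ < ε := by
  obtain ⟨x, hx⟩ := exists_norm_sub_toCompleted_lt ω hε
  obtain ⟨W, hW, h⟩ := exists_finiteDimensional_contract_eq_zero x
  refine ⟨W, hW, fun χ hχ => ?_⟩
  have h1 : dualEval ω χ = completedContract χ (ω - toCompleted F C A x) := by
    rw [completedContract_sub, completedContract_coe, h χ hχ, sub_zero, dualEval_apply]
  rw [h1]
  exact (norm_completedContract_le _ _).trans_lt hx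

/-- The elements of the dual whose image is small form an intersection of kernels of
evaluations. -/
theorem exists_separating (ω : CompletedTensor F C A) {r : ℝ} (hr : 0 < r)
    {ψ : Module.Dual F A} (hψ : r < ‖dualEval ω ψ‖) :
    ∃ v : A, ψ v ≠ 0 ∧ ∀ χ : Module.Dual F A, ‖dualEval ω χ‖ ≤ r → χ v = 0 := by
  obtain ⟨W, _, hW⟩ := exists_finiteDimensional_norm_dualEval_lt ω hr
  -- The ball is a subspace because the norm is ultrametric and scalars from `F` have norm at most
  -- 1. It contains every form vanishing on `W`, so `ψ` can be separated from it inside the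
  -- finite-dimensional dual of `W`, by an element of the bidual, that is of `W`.
  let B : Submodule F (Module.Dual F A) :=
    { carrier := {χ | ‖dualEval ω χ‖ ≤ r}
      zero_mem' := by simpa using hr.le
      add_mem' := fun {χ χ'} h h' => by
        simp only [Set.mem_ofPred_eq, map_add] at *
        exact (IsUltrametricDist.norm_add_le_max _ _).trans (max_le h h')
      smul_mem' := fun c χ h => by
        simp only [Set.mem_ofPred_eq, map_smul] at *
        exact (norm_smul_le' _ _).trans h }
  let R : Module.Dual F A →ₗ[F] Module.Dual F W := W.subtype.dualMap
  have hψB : R ψ ∉ B.map R := by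
    rintro ⟨χ, hχ, h⟩
    have h0 : ∀ v ∈ W, (ψ - χ) v = 0 := fun v hv => by
      have := LinearMap.congr_fun h ⟨v, hv⟩
      simp only [R, LinearMap.dualMap_apply, Submodule.subtype_apply] at this
      rw [LinearMap.sub_apply, this, sub_self]
    have h1 : ‖dualEval ω (ψ - χ)‖ ≤ r := (hW _ h0).le
    have h2 : ψ ∈ B := by
      rw [← sub_add_cancel ψ χ]
      exact B.add_mem h1 hχ
    exact absurd h2 (not_le.mpr hψ)
  obtain ⟨f, hf, hfB⟩ := Submodule.exists_dual_map_eq_bot_of_notMem hψB inferInstance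
  obtain ⟨v, rfl⟩ := (Module.evalEquiv F W).surjective f
  refine ⟨v, hf, fun χ hχ => ?_⟩
  have : Module.evalEquiv F W v (R χ) ∈ ((B.map R).map (Module.evalEquiv F W v)) :=
    Submodule.mem_map_of_mem (Submodule.mem_map_of_mem hχ)
  rw [hfB] at this
  exact this

theorem contract_sub_tmul_one (ω : CompletedTensor F C A) (χ₀ χ : Module.Dual F A) :
    completedContract χ (ω - toCompleted F C A (tmul F (dualEval ω χ₀) 1)) =
      dualEval ω (χ - χ 1 • χ₀) := by
  rw [completedContract_sub, completedContract_coe, contract_tmul, map_sub, map_smul]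
  rfl

/-- An element of `C ⊗̂ A` with a dominant constant coefficient is invertible. -/
theorem isUnit_of_dominant {ω : CompletedTensor F C A} {χ₀ : Module.Dual F A} (h₀ : χ₀ 1 = 1)
    {r : ℝ} (hr : r < ‖dualEval ω χ₀‖)
    (h : ∀ χ : Module.Dual F A, χ 1 = 0 → ‖dualEval ω χ‖ ≤ r) : IsUnit ω := by
  set c := dualEval ω χ₀ with hc
  have hr0 : 0 ≤ r := (norm_nonneg _).trans (h 0 rfl)
  have hc0 : 0 < ‖c‖ := hr0.trans_lt hr
  have hcne : c ≠ 0 := norm_pos_iff.mp hc0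
  let T : C → CompletedTensor F C A := fun d => toCompleted F C A (tmul F d 1)
  have hT : T c⁻¹ * T c = 1 := by
    change toCompleted F C A _ * toCompleted F C A _ = 1
    rw [← map_mul, tmul_mul_tmul, inv_mul_cancel₀ hcne, one_mul]
    exact map_one _
  -- Contracting `ω - c ⊗ 1` by `χ` amounts to evaluating `ω` at `χ - χ(1) χ₀`, which kills 1.
  have hrest : ‖ω - T c‖ ≤ r := norm_le_of_forall_completedContract fun χ => by
    rw [contract_sub_tmul_one]
    refine h _ ?_
    simp [h₀]
  have hTinv : ‖T c⁻¹‖ ≤ ‖c‖⁻¹ := by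
    rw [← norm_inv]
    exact (norm_toCompleted _).trans_le (tensor_norm_tmul_le _ _)
  have hlt : ‖T c⁻¹ * (T c - ω)‖ < 1 := by
    refine (norm_mul_le _ _).trans_lt ?_
    rw [norm_sub_rev]
    calc ‖T c⁻¹‖ * ‖ω - T c‖ ≤ ‖c‖⁻¹ * r :=
          mul_le_mul hTinv hrest (norm_nonneg _) (inv_nonneg.mpr hc0.le)
      _ < ‖c‖⁻¹ * ‖c‖ := by gcongr
      _ = 1 := inv_mul_cancel₀ hc0.ne'
  have hu := isUnit_one_sub_of_norm_lt_one hlt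
  have he : 1 - T c⁻¹ * (T c - ω) = T c⁻¹ * ω := by rw [mul_sub, hT]; ring
  rw [he] at hu
  exact isUnit_of_mul_isUnit_right hu

/-- Compactness of the dual: the norm of `dualEval ω` attains its minimum on the complement of the
kernel of an evaluation. -/
theorem exists_norm_dualEval_min (ω : CompletedTensor F C A) {v : A} (hv : v ≠ 0) :
    ∃ χ : Module.Dual F A, χ v ≠ 0 ∧
      ∀ ψ : Module.Dual F A, ψ v ≠ 0 → ‖dualEval ω χ‖ ≤ ‖dualEval ω ψ‖ := by
  classical
  let S : Set ℝ := {r | ∃ ψ : Module.Dual F A, ψ v ≠ 0 ∧ ‖dualEval ω ψ‖ = r}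
  have hS : S.Nonempty := by
    obtain ⟨ψ, hψ⟩ := Module.Projective.exists_dual_ne_zero F hv
    exact ⟨_, ψ, hψ, rfl⟩
  have hSb : BddBelow S := ⟨0, by rintro _ ⟨ψ, -, rfl⟩; exact norm_nonneg _⟩
  obtain ⟨u, -, hu, huS⟩ := exists_seq_tendsto_sInf hS hSb
  choose ψ hψv hψ using huS
  -- The pointwise limit of a minimizing sequence along an ultrafilter exists since `F` is finite;
  -- it agrees with `ψ n`, for suitable large `n`, on any given finite set.
  let 𝒢 : Ultrafilter ℕ := Filter.hyperfilter ℕ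
  have hlim : ∀ a : A, ∃ c : F, ∀ᶠ n in (𝒢 : Filter ℕ), ψ n a = c := fun a => by
    obtain ⟨c, hc⟩ := Ultrafilter.eq_pure_of_finite (𝒢.map fun n => ψ n a)
    refine ⟨c, ?_⟩
    have : {c} ∈ 𝒢.map fun n => ψ n a := by rw [hc]; exact Ultrafilter.mem_pure.mpr rfl
    exact this
  choose f hf using hlim
  let χ : Module.Dual F A :=
    { toFun := f
      map_add' := fun a b => by
        obtain ⟨n, h1, h2, h3⟩ := ((hf (a + b)).and ((hf a).and (hf b))).exists
        rw [← h1, ← h2, ← h3, map_add]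
      map_smul' := fun c a => by
        obtain ⟨n, h1, h2⟩ := ((hf (c • a)).and (hf a)).exists
        rw [← h1, ← h2, map_smul]; rfl }
  refine ⟨χ, ?_, fun ψ' hψ' => ?_⟩
  · obtain ⟨n, hn⟩ := (hf v).exists
    change f v ≠ 0
    rw [← hn]
    exact hψv n
  · refine le_trans ?_ (csInf_le hSb ⟨ψ', hψ', rfl⟩)
    refine le_of_forall_pos_le_add fun ε hε => ?_
    obtain ⟨W, _, hW⟩ := exists_finiteDimensional_norm_dualEval_lt ω (half_pos hε)
    obtain ⟨s, hs⟩ := (Module.Finite.iff_fg.mp ‹FiniteDimensional F W› : W.FG)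
    have h1 : ∀ᶠ n in (𝒢 : Filter ℕ), ∀ a ∈ s, ψ n a = f a :=
      (Filter.eventually_all_finset s).mpr fun a _ => hf a
    have h2 : ∀ᶠ n in (𝒢 : Filter ℕ), u n < sInf S + ε / 2 := by
      have : ∀ᶠ n in Filter.atTop, u n < sInf S + ε / 2 :=
        hu.eventually (gt_mem_nhds (by linarith))
      exact Nat.hyperfilter_le_atTop this
    obtain ⟨n, hn1, hn2⟩ := (h1.and h2).exists
    have h3 : ‖dualEval ω (χ - ψ n)‖ < ε / 2 := hW _ fun w hw => by
      rw [← hs] at hw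
      induction hw using Submodule.span_induction with
      | mem a ha => rw [LinearMap.sub_apply, hn1 a ha]; exact sub_self _
      | zero => exact map_zero _
      | add a b _ _ ha hb => rw [map_add, ha, hb, add_zero]
      | smul c a _ ha => rw [map_smul, ha, smul_zero]
    calc ‖dualEval ω χ‖ = ‖dualEval ω (χ - ψ n) + dualEval ω (ψ n)‖ := by
          rw [← map_add, sub_add_cancel]
      _ ≤ ‖dualEval ω (χ - ψ n)‖ + ‖dualEval ω (ψ n)‖ := norm_add_le _ _
      _ ≤ sInf S + ε := by rw [hψ n]; linarith

end Contraction

/-! ### Degrees of functions regular away from `∞` -/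

section Degree

theorem valuation_sum_eq_of_injOn {L Γ ι : Type*} [Ring L] [LinearOrderedCommGroupWithZero Γ]
    (v : Valuation L Γ) {s : Finset ι} (hs : s.Nonempty) {f : ι → L}
    (h0 : ∀ i ∈ s, v (f i) ≠ 0) (hinj : Set.InjOn (fun i => v (f i)) s) :
    ∃ i ∈ s, v (∑ j ∈ s, f j) = v (f i) ∧ ∀ j ∈ s, v (f j) ≤ v (f i) := by
  classical
  obtain ⟨i, hi, hmax⟩ := s.exists_max_image (fun i => v (f i)) hs
  refine ⟨i, hi, ?_, hmax⟩
  rw [← Finset.add_sum_erase s f hi]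
  refine Valuation.map_add_eq_of_lt_left _ (Valuation.map_sum_lt _ (h0 i hi) fun j hj => ?_)
  have hj' := Finset.mem_erase.mp hj
  exact lt_of_le_of_ne (hmax j hj'.2) fun h => hj'.1 (hinj hj'.2 hi h)

variable {F K : Type*} [Field F] [Finite F] [Field K] [Algebra F K]

namespace RationalPoint

variable (P : RationalPoint F K)

theorem val_algebraMap {c : F} (hc : c ≠ 0) : P.val (algebraMap F K c) = 1 := by
  have : IsOfFinOrder (Units.mk0 c hc) := isOfFinOrder_of_finite _
  obtain ⟨n, hn, h⟩ := isOfFinOrder_iff_pow_eq_one.mp this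
  have h' : c ^ n = 1 := by simpa using congrArg Units.val h
  have h2 : P.val (algebraMap F K c) ^ n = 1 := by rw [← map_pow, ← map_pow, h']; simp
  exact (pow_eq_one_iff_of_nonneg zero_le hn.ne').mp h2

theorem val_smul {c : F} (hc : c ≠ 0) (a : P.A) : P.val ((c • a : P.A) : K) = P.val a := by
  rw [Subalgebra.coe_smul, Algebra.smul_def, map_mul, P.val_algebraMap hc, one_mul]

variable {P}

theorem val_ne_zero {a : P.A} (ha : a ≠ 0) : P.val (a : K) ≠ 0 :=
  (Valuation.ne_zero_iff _).mpr fun h => ha (Subtype.ext h)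

theorem val_eq_exp_deg {a : P.A} (ha : a ≠ 0) : P.val (a : K) = WithZero.exp (P.deg a) :=
  (WithZero.exp_log (val_ne_zero ha)).symm

theorem deg_eq_of_val {a : P.A} {n : ℤ} (h : P.val (a : K) = WithZero.exp n) : P.deg a = n := by
  rw [deg, h, WithZero.log_exp]

theorem deg_lt_deg_iff {a b : P.A} (ha : a ≠ 0) (hb : b ≠ 0) :
    P.deg a < P.deg b ↔ P.val (a : K) < P.val b :=
  WithZero.log_lt_log (val_ne_zero ha) (val_ne_zero hb)

theorem deg_le_deg_iff {a b : P.A} (ha : a ≠ 0) (hb : b ≠ 0) :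
    P.deg a ≤ P.deg b ↔ P.val (a : K) ≤ P.val b :=
  WithZero.log_le_log (val_ne_zero ha) (val_ne_zero hb)

theorem deg_mul {a b : P.A} (ha : a ≠ 0) (hb : b ≠ 0) : P.deg (a * b) = P.deg a + P.deg b := by
  refine deg_eq_of_val ?_
  rw [Subalgebra.coe_mul, map_mul, val_eq_exp_deg ha, val_eq_exp_deg hb, WithZero.exp_add]

theorem deg_pow {a : P.A} (ha : a ≠ 0) (n : ℕ) : P.deg (a ^ n) = n * P.deg a := by
  induction n with
  | zero => simp [deg]
  | succ n ih => rw [pow_succ, deg_mul (pow_ne_zero n ha) ha, ih]; push_cast; ring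

theorem val_lt_exp_iff {a : P.A} (ha : a ≠ 0) {n : ℤ} :
    P.val (a : K) < WithZero.exp n ↔ P.deg a < n := by
  rw [val_eq_exp_deg ha, WithZero.exp_lt_exp]

/-- Two functions with the same pole order at a rational point are proportional up to a function
with a smaller pole order. -/
theorem exists_val_sub_smul_lt {a b : P.A} (hb : b ≠ 0) (h : P.val (a : K) = P.val b) :
    ∃ c : F, c ≠ 0 ∧ P.val ((a - c • b : P.A) : K) < P.val b := by
  have hb' : (b : K) ≠ 0 := fun h => hb (Subtype.ext h)
  have hv := val_ne_zero hb
  have h1 : P.val ((a : K) / b) = 1 := by rw [map_div₀, h, div_self hv]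
  obtain ⟨c, hc⟩ := P.residue _ h1.le
  refine ⟨c, ?_, ?_⟩
  · rintro rfl
    rw [map_zero, sub_zero, h1] at hc
    exact lt_irrefl _ hc
  · have : ((a - c • b : P.A) : K) = ((a : K) / b - algebraMap F K c) * b := by
      rw [Subalgebra.coe_sub, Subalgebra.coe_smul, Algebra.smul_def, sub_mul, div_mul_cancel₀ _ hb']
    rw [this, map_mul]
    exact mul_lt_of_lt_one_left (zero_lt_iff.mpr hv) hc

section Curve

variable [IsCurveFunctionField F K]

/-- A function without poles that vanishes at `∞` is zero: lying in every valuation ring of `K`, it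
is integral over the prime ring, hence algebraic over `F`, hence constant, and nonzero constants
have valuation 1. -/
theorem eq_zero_of_val_lt_one {a : P.A} (h : P.val (a : K) < 1) : a = 0 := by
  by_contra ha
  have hmem : ∀ V : ValuationSubring K, (a : K) ∈ V := fun V => by
    by_cases hV : V = P.val.valuationSubring
    · rw [hV]; exact h.le
    · exact a.2 V hV
  have hint : (a : K) ∈ (integralClosure (Subring.closure (∅ : Set K)) K).toSubring := by
    rw [← iInf_valuationSubring_superset, Subring.mem_iInf]
    exact fun V => hmem V.1
  have halg : IsIntegral F (a : K) := by
    have h1 : IsIntegral (Subring.closure (∅ : Set K)) (a : K) := hint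
    have hle : Subring.closure (∅ : Set K) ≤ (algebraMap F K).range :=
      Subring.closure_le.mpr (Set.empty_subset _)
    let e : F ≃+* (algebraMap F K).range := RingEquiv.ofBijective (algebraMap F K).rangeRestrict
      ⟨(algebraMap F K).rangeRestrict.injective, (algebraMap F K).rangeRestrict_surjective⟩
    let f : Subring.closure (∅ : Set K) →+* F :=
      e.symm.toRingHom.comp (Subring.inclusion hle)
    have hf : (algebraMap F K).comp f = algebraMap (Subring.closure (∅ : Set K)) K := by
      ext x
      exact congrArg Subtype.val (e.apply_symm_apply (Subring.inclusion hle x))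
    obtain ⟨p, hp, hpa⟩ := h1
    exact ⟨p.map f, hp.map _, by rw [Polynomial.eval₂_map, hf]; exact hpa⟩
  obtain ⟨c, hc⟩ := IsCurveFunctionField.mem_range_of_isAlgebraic (F := F) _ halg.isAlgebraic
  have hc0 : c ≠ 0 := by
    rintro rfl
    exact ha (Subtype.ext (by rw [← hc]; simp))
  rw [← hc, P.val_algebraMap hc0] at h
  exact lt_irrefl _ h

theorem deg_nonneg {a : P.A} (ha : a ≠ 0) : 0 ≤ P.deg a := by
  by_contra h
  exact ha (eq_zero_of_val_lt_one (by
    rw [← WithZero.exp_zero, val_lt_exp_iff ha]; exact not_le.mp h))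

theorem exists_eq_algebraMap_of_deg_eq_zero {a : P.A} (ha : a ≠ 0) (h : P.deg a = 0) :
    ∃ c : F, a = algebraMap F P.A c := by
  have h1 : P.val (a : K) = P.val ((1 : P.A) : K) := by
    rw [val_eq_exp_deg ha, h]; simp
  obtain ⟨c, -, hc⟩ := exists_val_sub_smul_lt one_ne_zero h1
  refine ⟨c, ?_⟩
  rw [Algebra.algebraMap_eq_smul_one, ← sub_eq_zero]
  exact eq_zero_of_val_lt_one (by simpa using hc)

end Curve

end RationalPoint

end Degree

/-! ### Division with remainder in `A`, the Dedekind property, and torsion of the dual -/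

section CoordinateRing

variable {F K : Type*} [Field F] [Finite F] [Field K] [Algebra F K]

namespace RationalPoint

variable {P : RationalPoint F K}

/-- A function of positive degree is transcendental; its polynomials have the expected degree. -/
theorem val_aeval {a : P.A} (ha : 0 < P.deg a) {p : Polynomial F} (hp : p ≠ 0) :
    P.val (Polynomial.aeval (a : K) p) = WithZero.exp (p.natDegree * P.deg a) := by
  have ha0 : a ≠ 0 := by rintro rfl; simp [deg] at ha
  have hpow : ∀ n : ℕ, P.val ((a : K) ^ n) = WithZero.exp (n * P.deg a) := fun n => by
    rw [map_pow, val_eq_exp_deg ha0, ← WithZero.exp_nsmul, nsmul_eq_mul]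
  have hterm : ∀ n, p.coeff n ≠ 0 →
      P.val (p.coeff n • (a : K) ^ n) = WithZero.exp (n * P.deg a) := fun n hn => by
    rw [Algebra.smul_def, map_mul, P.val_algebraMap hn, one_mul, hpow]
  rw [Polynomial.aeval_eq_sum_range, Finset.sum_range_succ,
    ← hterm p.natDegree (by simpa using hp)]
  refine Valuation.map_add_eq_of_lt_right _ (Valuation.map_sum_lt _ ?_ fun i hi => ?_)
  · rw [hterm _ (by simpa using hp)]; exact WithZero.exp_ne_zero
  · rw [hterm p.natDegree (by simpa using hp)]
    by_cases hc : p.coeff i = 0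
    · rw [hc, zero_smul, map_zero]; exact WithZero.exp_pos
    · rw [hterm i hc, WithZero.exp_lt_exp]
      have : (i : ℤ) < p.natDegree := by exact_mod_cast Finset.mem_range.mp hi
      exact mul_lt_mul_of_pos_right this ha

theorem transcendental_of_deg_pos {a : P.A} (ha : 0 < P.deg a) : Transcendental F (a : K) := by
  rintro ⟨p, hp, h⟩
  have := val_aeval ha hp
  rw [h, map_zero] at this
  exact WithZero.exp_ne_zero this.symm

/-- `A` is an intersection of valuation rings, each of which is integrally closed. -/
theorem mem_A_of_isIntegral {S : Subalgebra F K} (hS : S ≤ P.A) {x : K} (hx : IsIntegral S x) :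
    x ∈ P.A := by
  intro O hO
  have hSO : ∀ y ∈ S, y ∈ O := fun y hy => hS hy O hO
  let f : S →+* O := (algebraMap S K).codRestrict O.toSubring fun y => hSO y y.2
  have h : IsIntegral O x := by
    obtain ⟨p, hp, hpx⟩ := hx
    refine ⟨p.map f, hp.map _, ?_⟩
    rw [Polynomial.eval₂_map]
    exact hpx
  obtain ⟨y, hy⟩ := IsIntegrallyClosed.isIntegral_iff.mp h
  rw [← hy]
  exact y.2

section Curve

variable [IsCurveFunctionField F K]

/-- The transcendence degree of `K` is at most 1, so a single transcendental element is already a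
transcendence basis. -/
theorem isAlgebraic_adjoin {t : K} (ht : Transcendental F t) :
    Algebra.IsAlgebraic (Algebra.adjoin F {t}) K := by
  obtain ⟨t₀, ht₀, hfin⟩ := IsCurveFunctionField.exists_finite (F := F) (K := K)
  have halg₀ : Algebra.IsAlgebraic (Algebra.adjoin F {t₀}) K := by
    have h1 : Algebra.IsAlgebraic (IntermediateField.adjoin F {t₀}) K := inferInstance
    exact ⟨fun x => IntermediateField.isAlgebraic_adjoin_iff.mp (h1.isAlgebraic x)⟩
  have hle : Algebra.trdeg F K ≤ 1 := by
    simpa using Algebra.IsAlgebraic.trdeg_le_cardinalMk F ({t₀} : Set K)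
  have hind : AlgebraicIndependent F (fun _ : Unit => t) :=
    algebraicIndependent_unique_type_iff.mpr ht
  have hb := hind.isTranscendenceBasis_of_lift_trdeg_le_of_finite (by simpa using hle)
  have := hb.isAlgebraic
  rwa [Set.range_const] at this

/-- Denominators can be cleared by polynomials in a given function of positive degree. -/
theorem exists_aeval_mul_mem_A {a : P.A} (ha : 0 < P.deg a) (x : K) :
    ∃ p : Polynomial F, p ≠ 0 ∧ Polynomial.aeval (a : K) p * x ∈ P.A := by
  have := isAlgebraic_adjoin (transcendental_of_deg_pos ha)
  obtain ⟨y, hy, hint⟩ := (this.isAlgebraic x).exists_integral_multiple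
  obtain ⟨p, hp⟩ : ∃ p : Polynomial F, Polynomial.aeval (a : K) p = (y : K) := by
    have hy' : ∀ z ∈ Algebra.adjoin F {(a : K)}, z ∈ (Polynomial.aeval (R := F) (a : K)).range := by
      rw [Algebra.adjoin_singleton_eq_range_aeval]; exact fun _ h => h
    exact hy' y y.2
  refine ⟨p, ?_, ?_⟩
  · rintro rfl
    exact hy (Subtype.ext (by rw [← hp]; simp))
  · have h1 : y • x = Polynomial.aeval (a : K) p * x := by
      rw [Subalgebra.smul_def, ← hp]; rfl
    rw [← h1]
    exact mem_A_of_isIntegral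
      (Algebra.adjoin_le (Set.singleton_subset_iff.mpr a.2)) hint

/-- Clearing the denominators of an element of `K` by a polynomial in `a` changes its degree by a
multiple of `deg a` only. -/
theorem exists_deg_emod {a : P.A} (ha : 0 < P.deg a) (k : ℤ) :
    ∃ y : P.A, y ≠ 0 ∧ P.deg y % P.deg a = k % P.deg a := by
  obtain ⟨x, hx⟩ := P.surjective (WithZero.exp k)
  obtain ⟨p, hp, h⟩ := exists_aeval_mul_mem_A ha x
  have hv : P.val (Polynomial.aeval (a : K) p * x) =
      WithZero.exp (p.natDegree * P.deg a + k) := by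
    rw [map_mul, val_aeval ha hp, hx, WithZero.exp_add]
  refine ⟨⟨_, h⟩, ?_, ?_⟩
  · intro h0
    rw [show Polynomial.aeval (a : K) p * x = 0 from congrArg Subtype.val h0, map_zero] at hv
    exact WithZero.exp_ne_zero hv.symm
  · rw [deg_eq_of_val hv, Int.mul_add_emod_self_right]

/-- In every residue class modulo `deg a` there is a function of minimal degree. -/
theorem exists_minimal_deg_emod {a : P.A} (ha : 0 < P.deg a) (k : ℤ) :
    ∃ x : P.A, x ≠ 0 ∧ P.deg x % P.deg a = k % P.deg a ∧
      ∀ y : P.A, y ≠ 0 → P.deg y % P.deg a = k % P.deg a → P.deg x ≤ P.deg y := by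
  classical
  have hex : ∃ n : ℕ, ∃ y : P.A, y ≠ 0 ∧ P.deg y % P.deg a = k % P.deg a ∧ P.deg y = n := by
    obtain ⟨y, hy, h⟩ := exists_deg_emod ha k
    exact ⟨(P.deg y).toNat, y, hy, h, (Int.toNat_of_nonneg (deg_nonneg hy)).symm⟩
  obtain ⟨x, hx, hk, hn⟩ := Nat.find_spec hex
  refine ⟨x, hx, hk, fun y hy h => ?_⟩
  have := Nat.find_min' hex ⟨y, hy, h, (Int.toNat_of_nonneg (deg_nonneg hy)).symm⟩
  have h2 := Int.toNat_of_nonneg (deg_nonneg hy)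
  omega

/-- Division with remainder by a function of positive degree. -/
theorem exists_remainders {a : P.A} (ha : 0 < P.deg a) :
    ∃ s : Finset P.A, ∀ y : P.A, ∃ z ∈ Submodule.span F (s : Set P.A), ∃ u : P.A,
      y = z + a * u ∧ P.val ((a * u : P.A) : K) ≤ P.val (y : K) := by
  classical
  have ha0 : a ≠ 0 := by rintro rfl; simp [deg] at ha
  choose x hx0 hxk hxmin using exists_minimal_deg_emod (P := P) ha
  let s : Finset P.A := (Finset.Ico 0 (P.deg a)).image x
  refine ⟨s, ?_⟩
  -- The induction bounds the valuation rather than the degree so as to include `y = 0`, whose `deg`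
  -- is 0 by convention.
  suffices H : ∀ (n : ℕ) (y : P.A), P.val (y : K) < WithZero.exp (n : ℤ) →
      ∃ z ∈ Submodule.span F (s : Set P.A), ∃ u : P.A,
        y = z + a * u ∧ P.val ((a * u : P.A) : K) ≤ P.val (y : K) by
    intro y
    rcases eq_or_ne y 0 with rfl | hy
    · exact H 0 0 (by simp)
    · refine H ((P.deg y).toNat + 1) y ((val_lt_exp_iff hy).mpr ?_)
      have := Int.toNat_of_nonneg (deg_nonneg hy)
      omega
  intro n
  induction n with
  | zero =>
    intro y hy
    have hy0 : y = 0 := eq_zero_of_val_lt_one (by simpa using hy)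
    exact ⟨0, Submodule.zero_mem _, 0, by simp [hy0], by simp⟩
  | succ n ih =>
    intro y hy
    rcases lt_or_ge (P.val (y : K)) (WithZero.exp (n : ℤ)) with h | h
    · exact ih y h
    have hy0 : y ≠ 0 := by
      rintro rfl
      simp at h
    have hdeg : P.deg y = n := by
      have h1 := (val_lt_exp_iff hy0).mp hy
      have h2 : ¬ P.deg y < n := fun h' => absurd ((val_lt_exp_iff hy0).mpr h') (not_lt.mpr h)
      push_cast at h1
      omega
    set k := P.deg y % P.deg a with hk
    have hkmem : k ∈ Finset.Ico 0 (P.deg a) :=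
      Finset.mem_Ico.mpr ⟨Int.emod_nonneg _ ha.ne', Int.emod_lt_of_pos _ ha⟩
    have hkk : k % P.deg a = k := Int.emod_emod _ _
    have hle : P.deg (x k) ≤ P.deg y := hxmin k y hy0 hkk.symm
    obtain ⟨j, hj⟩ : P.deg a ∣ P.deg y - P.deg (x k) := by
      refine Int.dvd_of_emod_eq_zero (Int.emod_eq_emod_iff_emod_sub_eq_zero.mp ?_)
      rw [hxk k, hkk]
    have hj0 : 0 ≤ j := by
      by_contra hneg
      have := mul_neg_of_pos_of_neg ha (not_le.mp hneg)
      omega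
    lift j to ℕ using hj0
    -- The leading term of `y` is matched by a scalar multiple of `a ^ j * x k`. This goes into the
    -- remainder if `j = 0` and into the multiple of `a` otherwise.
    have hval : P.val (y : K) = P.val ((a ^ j * x k : P.A) : K) := by
      have h0 := mul_ne_zero (pow_ne_zero j ha0) (hx0 k)
      rw [val_eq_exp_deg hy0, val_eq_exp_deg h0, deg_mul (pow_ne_zero j ha0) (hx0 k), deg_pow ha0]
      congr 1
      linarith
    have hne := mul_ne_zero (pow_ne_zero j ha0) (hx0 k)
    obtain ⟨c, hc0, hc⟩ := exists_val_sub_smul_lt hne hval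
    rw [← hval] at hc
    obtain ⟨z, hz, u, hzu, hu⟩ := ih _ (hc.trans_le (by
      rw [val_eq_exp_deg hy0, hdeg]))
    rcases Nat.eq_zero_or_pos j with rfl | hjpos
    · refine ⟨z + c • x k, Submodule.add_mem _ hz (Submodule.smul_mem _ _
        (Submodule.subset_span (Finset.mem_coe.mpr (Finset.mem_image_of_mem x hkmem)))), u, ?_,
        hu.trans hc.le⟩
      rw [pow_zero, one_mul, sub_eq_iff_eq_add] at hzu
      rw [hzu]; ring
    · obtain ⟨i, rfl⟩ := Nat.exists_eq_add_of_lt hjpos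
      have he : a * (u + c • (a ^ i * x k)) = a * u + c • (a ^ (0 + i + 1) * x k) := by
        rw [mul_add, mul_smul_comm]
        congr 2
        ring
      refine ⟨z, hz, u + c • (a ^ i * x k), ?_, ?_⟩
      · rw [sub_eq_iff_eq_add] at hzu
        rw [he, ← add_assoc]
        exact hzu
      · rw [he]
        refine (P.val.map_add _ _).trans (max_le (hu.trans hc.le) ?_)
        rw [hval]
        exact (P.val_smul hc0 _).le

/-- Generators are `a` and the finitely many elements spanning the remainders: in `y = z + a * u` a
nonzero `u` has smaller degree than the bound on `y`, so division can be iterated. -/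
theorem algebra_finiteType {a : P.A} (ha : 0 < P.deg a) : Algebra.FiniteType F P.A := by
  classical
  obtain ⟨s, hs⟩ := exists_remainders ha
  refine ⟨⟨insert a s, ?_⟩⟩
  rw [eq_top_iff]
  have ha0 : a ≠ 0 := by rintro rfl; simp [deg] at ha
  suffices H : ∀ (n : ℕ) (y : P.A), P.val (y : K) < WithZero.exp (n : ℤ) →
      y ∈ Algebra.adjoin F ((insert a s : Finset P.A) : Set P.A) by
    intro y _
    rcases eq_or_ne y 0 with rfl | hy
    · exact zero_mem _
    · refine H ((P.deg y).toNat + 1) y ((val_lt_exp_iff hy).mpr ?_)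
      have := Int.toNat_of_nonneg (deg_nonneg hy)
      omega
  intro n
  induction n with
  | zero =>
    intro y hy
    rw [eq_zero_of_val_lt_one (by simpa using hy : P.val (y : K) < 1)]
    exact zero_mem _
  | succ n ih =>
    intro y hy
    obtain ⟨z, hz, u, hzu, hu⟩ := hs y
    have hzm : z ∈ Algebra.adjoin F ((insert a s : Finset P.A) : Set P.A) := by
      refine Algebra.span_le_adjoin F _ (Submodule.span_mono ?_ hz)
      exact Finset.coe_subset.mpr (Finset.subset_insert a s)
    have hum : u ∈ Algebra.adjoin F ((insert a s : Finset P.A) : Set P.A) := by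
      rcases eq_or_ne u 0 with rfl | hu0
      · exact zero_mem _
      · refine ih u ((val_lt_exp_iff hu0).mpr ?_)
        have := (val_lt_exp_iff (mul_ne_zero ha0 hu0)).mp (hu.trans_lt hy)
        rw [deg_mul ha0 hu0] at this
        push_cast at this
        omega
    rw [hzu]
    exact add_mem hzm (mul_mem (Algebra.subset_adjoin (by simp)) hum)

theorem finite_quotient {a : P.A} (ha : 0 < P.deg a) : Finite (P.A ⧸ Ideal.span {a}) := by
  obtain ⟨s, hs⟩ := exists_remainders ha
  have : Finite (Submodule.span F (s : Set P.A)) := Module.finite_of_finite F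
  refine Finite.of_surjective
    (fun z : Submodule.span F (s : Set P.A) => Ideal.Quotient.mk (Ideal.span {a}) (z : P.A)) ?_
  intro y
  obtain ⟨y, rfl⟩ := Ideal.Quotient.mk_surjective y
  obtain ⟨z, hz, u, hzu, -⟩ := hs y
  refine ⟨⟨z, hz⟩, ?_⟩
  rw [hzu, eq_comm, Ideal.Quotient.eq, add_sub_cancel_left]
  exact Ideal.mul_mem_right _ _ (Ideal.mem_span_singleton_self a)

/-- The ring of functions regular away from `∞` is a Dedekind domain. -/
theorem isDedekindDomain_A {a : P.A} (ha : 0 < P.deg a) : IsDedekindDomain P.A := by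
  have := algebra_finiteType ha
  have hN : IsNoetherianRing P.A := Algebra.FiniteType.isNoetherianRing F P.A
  -- A nonzero prime contains some `b` of positive degree, so its residue ring is a finite domain,
  -- that is a field.
  have hD : Ring.DimensionLEOne P.A := ⟨fun {p} hp hprime => by
    obtain ⟨b, hbp, hb0⟩ := Submodule.exists_mem_ne_zero_of_ne_bot hp
    have hb : 0 < P.deg b := by
      refine lt_of_le_of_ne (deg_nonneg hb0) fun h => ?_
      obtain ⟨c, rfl⟩ := exists_eq_algebraMap_of_deg_eq_zero hb0 h.symm
      have hc : c ≠ 0 := by rintro rfl; exact hb0 (map_zero _)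
      exact hprime.ne_top (Ideal.eq_top_of_isUnit_mem _ hbp ((IsUnit.mk0 c hc).map _))
    have := finite_quotient hb
    have hle : Ideal.span {b} ≤ p := (Ideal.span_singleton_le_iff_mem p).mpr hbp
    have : Finite (P.A ⧸ p) := Finite.of_surjective _ (Ideal.Quotient.factor_surjective hle)
    exact Ideal.Quotient.maximal_of_isField p (Finite.isField_of_domain _)⟩
  have hfrac : IsFractionRing P.A K := IsFractionRing.of_field P.A K fun z => by
    obtain ⟨p, hp, h⟩ := exists_aeval_mul_mem_A ha z
    have hval := val_aeval ha hp
    have h0 : Polynomial.aeval (a : K) p ≠ 0 := fun h => by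
      rw [h, map_zero] at hval
      exact WithZero.exp_ne_zero hval.symm
    refine ⟨⟨_, h⟩, Polynomial.aeval a p, ?_⟩
    have he : algebraMap P.A K (Polynomial.aeval a p) = Polynomial.aeval (a : K) p :=
      (Polynomial.aeval_algebraMap_apply K a p).symm
    rw [he]
    exact (mul_div_cancel_left₀ z h0).symm
  have hI : IsIntegrallyClosed P.A := by
    rw [isIntegrallyClosed_iff K]
    intro x hx
    exact ⟨⟨x, mem_A_of_isIntegral le_rfl hx⟩, rfl⟩
  have : IsDedekindRing P.A := {}
  exact {}

/-- Independence of the minimal elements modulo `a`. Their degrees lie in distinct residue classes,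
so a nontrivial combination has the degree of some `x i`; were it `a * u`, then `u` would have
smaller degree than `x i` in the same class. -/
theorem eq_zero_of_sum_smul_eq_mul {a : P.A} (ha : 0 < P.deg a) {x : ℤ → P.A} (hx0 : ∀ k, x k ≠ 0)
    (hxk : ∀ k, P.deg (x k) % P.deg a = k % P.deg a)
    (hxmin : ∀ k, ∀ y : P.A, y ≠ 0 → P.deg y % P.deg a = k % P.deg a → P.deg (x k) ≤ P.deg y)
    {c : Fin (P.deg a).toNat → F} {u : P.A} (h : ∑ i, c i • x (i : ℕ) = a * u) : c = 0 := by
  classical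
  by_contra hc
  have ha0 : a ≠ 0 := by rintro rfl; simp [deg] at ha
  have hd := Int.toNat_of_nonneg ha.le
  let s : Finset (Fin (P.deg a).toNat) := Finset.univ.filter fun i => c i ≠ 0
  have hs : s.Nonempty := by
    obtain ⟨i, hi⟩ := Function.ne_iff.mp hc
    exact ⟨i, Finset.mem_filter.mpr ⟨Finset.mem_univ _, hi⟩⟩
  have hmod : ∀ i : Fin (P.deg a).toNat, ((i : ℕ) : ℤ) % P.deg a = (i : ℕ) := fun i =>
    Int.emod_eq_of_lt (by positivity) (by have := i.2; omega)
  have hv : ∀ i ∈ s, P.val ((c i • x (i : ℕ) : P.A) : K) = P.val (x (i : ℕ) : K) := fun i hi =>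
    P.val_smul (Finset.mem_filter.mp hi).2 _
  obtain ⟨i, hi, hval, -⟩ := valuation_sum_eq_of_injOn P.val hs
    (f := fun i : Fin (P.deg a).toNat => ((c i • x (i : ℕ) : P.A) : K))
    (fun i hi => by rw [hv i hi]; exact val_ne_zero (hx0 _))
    (fun i hi j hj hij => by
      simp only [hv i hi, hv j hj] at hij
      have h1 : P.deg (x (i : ℕ)) = P.deg (x (j : ℕ)) := congrArg WithZero.log hij
      have h2 := hxk (i : ℕ)
      rw [h1, hxk, hmod, hmod] at h2
      exact Fin.ext (by exact_mod_cast h2.symm))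
  have hsum : ∑ j ∈ s, ((c j • x (j : ℕ) : P.A) : K) = ((a * u : P.A) : K) := by
    rw [← h, Finset.sum_filter_of_ne, AddSubmonoidClass.coe_finsetSum]
    rintro j - hj hcj
    rw [hcj, zero_smul] at hj
    exact hj rfl
  rw [hsum, hv i hi] at hval
  have hu0 : u ≠ 0 := by
    rintro rfl
    rw [mul_zero] at hval
    exact val_ne_zero (hx0 _) (hval.symm.trans (by simp))
  have hdeg : P.deg a + P.deg u = P.deg (x (i : ℕ)) := by
    rw [← deg_mul ha0 hu0]
    exact congrArg WithZero.log hval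
  have := hxmin (i : ℕ) u hu0 (by rw [← hxk (i : ℕ), ← hdeg, Int.add_emod_left])
  omega

/-- The `a`-torsion of the dual of `A` has at least `q ^ deg a` elements. -/
theorem exists_injective_torsion {a : P.A} (ha : a ≠ 0) :
    ∃ g : (Fin (P.deg a).toNat → F) → Module.Dual F P.A, Function.Injective g ∧
      ∀ c, g c ∘ₗ LinearMap.mulLeft F a = 0 := by
  rcases (deg_nonneg ha).eq_or_lt with h | h
  · have : IsEmpty (Fin (P.deg a).toNat) := by rw [← h]; exact Fin.isEmpty'
    exact ⟨fun _ => 0, Function.injective_of_subsingleton _, fun c => LinearMap.zero_comp _⟩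
  choose x hx0 hxk hxmin using exists_minimal_deg_emod (P := P) h
  let N : Submodule F P.A := LinearMap.range (LinearMap.mulLeft F a)
  let l : (Fin (P.deg a).toNat → F) →ₗ[F] P.A ⧸ N :=
    N.mkQ ∘ₗ Fintype.linearCombination F fun i : Fin (P.deg a).toNat => x (i : ℕ)
  have hl : LinearMap.ker l = ⊥ := by
    refine LinearMap.ker_eq_bot'.mpr fun c hc => ?_
    have hc' : Fintype.linearCombination F (fun i : Fin (P.deg a).toNat => x (i : ℕ)) c ∈ N :=
      (Submodule.Quotient.mk_eq_zero N).mp hc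
    obtain ⟨u, hu⟩ := hc'
    rw [Fintype.linearCombination_apply] at hu
    exact eq_zero_of_sum_smul_eq_mul h hx0 hxk hxmin hu.symm
  obtain ⟨π, hπ⟩ := l.exists_leftInverse_of_injective hl
  refine ⟨fun c => (Fintype.linearCombination F c) ∘ₗ π ∘ₗ N.mkQ, fun c c' hcc => ?_, fun c => ?_⟩
  · funext i
    have h1 := LinearMap.congr_fun hcc (x (i : ℕ))
    have h2 : π (N.mkQ (x (i : ℕ))) = Pi.single i 1 := by
      have := LinearMap.congr_fun hπ (Pi.single i 1)
      simpa [l, Fintype.linearCombination_apply_single] using this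
    simp only [LinearMap.comp_apply, h2] at h1
    simpa [Fintype.linearCombination_apply_single] using h1
  · ext u
    have : N.mkQ (a * u) = 0 := (Submodule.Quotient.mk_eq_zero N).mpr ⟨u, rfl⟩
    simp only [LinearMap.comp_apply, LinearMap.mulLeft_apply, this, map_zero, LinearMap.zero_apply]

end Curve

end RationalPoint

end CoordinateRing

/-! ### Minimal norms on the dual, injectivity of generators, and torsion in rank one -/

section Torsion

/-- The fraction `s / t` lies in the inverse of `I` but not in `R`: write `(t) = I J` and take `s`
in `J` outside `(t)`, which is possible because `I` is not the unit ideal. -/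
theorem exists_mul_dvd_not_dvd {R : Type*} [CommRing R] [IsDedekindDomain R] {I : Ideal R}
    (h0 : I ≠ ⊥) (h1 : I ≠ ⊤) :
    ∃ s t : R, t ≠ 0 ∧ (∀ x ∈ I, t ∣ s * x) ∧ ¬ t ∣ s := by
  obtain ⟨t, htI, ht⟩ := Submodule.exists_mem_ne_zero_of_ne_bot h0
  obtain ⟨J, hJ⟩ : I ∣ Ideal.span {t} :=
    Ideal.dvd_iff_le.mpr ((Ideal.span_singleton_le_iff_mem I).mpr htI)
  have hJ0 : J ≠ 0 := by
    rintro rfl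
    rw [mul_zero] at hJ
    exact ht (Ideal.span_singleton_eq_bot.mp hJ)
  have hnle : ¬ J ≤ Ideal.span {t} := fun hle => by
    have h2 : I * J ∣ J := hJ ▸ Ideal.dvd_iff_le.mpr hle
    obtain ⟨L, hL⟩ := h2
    have h3 : I * L = 1 := by
      have : J * (I * L) = J * 1 := by rw [mul_one]; nth_rw 2 [hL]; ring
      exact mul_left_cancel₀ hJ0 this
    exact h1 (Ideal.isUnit_iff.mp (IsUnit.of_mul_eq_one L h3))
  obtain ⟨s, hsJ, hs⟩ := SetLike.not_le_iff_exists.mp hnle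
  refine ⟨s, t, ht, fun x hx => ?_, fun h => hs (Ideal.mem_span_singleton.mpr h)⟩
  rw [← Ideal.mem_span_singleton, hJ, mul_comm s]
  exact Ideal.mul_mem_mul hx hsJ

section MinNorm

variable {F C A : Type*} [Field F] [Finite F] [NormedField C] [IsUltrametricDist C]
  [CompleteSpace C] [Algebra F C] [CommRing A] [Algebra F A]

/-- The minimal norm of `ω` on the complement of the kernel of the evaluation at `v`. -/
def minNorm (ω : CompletedTensor F C A) (v : A) : ℝ :=
  sInf {r | ∃ χ : Module.Dual F A, χ v ≠ 0 ∧ ‖dualEval ω χ‖ = r}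

theorem minNorm_le (ω : CompletedTensor F C A) {v : A} {χ : Module.Dual F A} (h : χ v ≠ 0) :
    minNorm ω v ≤ ‖dualEval ω χ‖ :=
  csInf_le ⟨0, by rintro _ ⟨ψ, -, rfl⟩; exact norm_nonneg _⟩ ⟨χ, h, rfl⟩

theorem exists_norm_eq_minNorm (ω : CompletedTensor F C A) {v : A} (hv : v ≠ 0) :
    ∃ χ : Module.Dual F A, χ v ≠ 0 ∧ ‖dualEval ω χ‖ = minNorm ω v := by
  obtain ⟨χ, hχ, hmin⟩ := exists_norm_dualEval_min ω hv
  refine ⟨χ, hχ, le_antisymm (le_csInf ⟨_, χ, hχ, rfl⟩ ?_) (minNorm_le ω hχ)⟩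
  rintro _ ⟨ψ, hψ, rfl⟩
  exact hmin ψ hψ

theorem minNorm_pos {ω : CompletedTensor F C A} (hω : Function.Injective (dualEval ω)) {v : A}
    (hv : v ≠ 0) : 0 < minNorm ω v := by
  obtain ⟨χ, hχ, h⟩ := exists_norm_eq_minNorm ω hv
  rw [← h, norm_pos_iff, ne_eq, map_eq_zero_iff _ hω]
  rintro rfl
  exact hχ rfl

/-- A form that is nonzero at `v + w` is nonzero at `v` or at `w`. -/
theorem min_minNorm_le_add (ω : CompletedTensor F C A) {v w : A} (h : v + w ≠ 0) :
    min (minNorm ω v) (minNorm ω w) ≤ minNorm ω (v + w) := by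
  obtain ⟨χ, hχ, h⟩ := exists_norm_eq_minNorm ω h
  rw [← h]
  by_cases hv : χ v = 0
  · refine (min_le_right _ _).trans (minNorm_le ω fun hw => hχ ?_)
    rw [map_add, hv, hw, add_zero]
  · exact (min_le_left _ _).trans (minNorm_le ω hv)

theorem minNorm_smul (ω : CompletedTensor F C A) {c : F} (hc : c ≠ 0) (v : A) :
    minNorm ω (c • v) = minNorm ω v := by
  simp only [minNorm, map_smul, smul_eq_mul, ne_eq, mul_eq_zero, hc, false_or]

theorem minNorm_neg (ω : CompletedTensor F C A) (v : A) : minNorm ω (-v) = minNorm ω v := by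
  simp only [minNorm, map_neg, ne_eq, neg_eq_zero]

/-- By continuity `ω` is smaller than `r` on forms killing some finite `W`, and every `v` outside
`W` is detected by such a form. -/
theorem finite_le_minNorm (ω : CompletedTensor F C A) {r : ℝ} (hr : 0 < r) :
    {v : A | v ≠ 0 ∧ r ≤ minNorm ω v}.Finite := by
  obtain ⟨W, _, hW⟩ := exists_finiteDimensional_norm_dualEval_lt ω hr
  have hfin : Finite W := Module.finite_of_finite F
  refine Set.Finite.subset (Set.toFinite (W : Set A)) fun v hv => ?_
  by_contra hvW
  obtain ⟨f, hf, hfW⟩ := Submodule.exists_le_ker_of_notMem hvW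
  exact absurd ((hv.2.trans (minNorm_le ω hf)).trans_lt (hW f fun w hw => hfW hw)) (lt_irrefl _)

end MinNorm

section RootProduct

variable {C : Type*} [NormedField C] [IsUltrametricDist C]

theorem norm_sub_eq_max_of_le {x t : C} (h : ‖x‖ ≤ ‖x - t‖) : ‖x - t‖ = max ‖x‖ ‖t‖ := by
  refine le_antisymm ?_ (max_le h ?_)
  · simpa [sub_eq_add_neg] using IsUltrametricDist.norm_add_le_max x (-t)
  · have := IsUltrametricDist.norm_add_le_max x (-(x - t))
    rw [norm_neg, max_eq_right h] at this
    simpa using this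

/-- The root 0 contributes the strictly increasing factor `r`; the other factors are positive and
nondecreasing. -/
theorem strictMonoOn_prod_max {T : Finset C} (h0 : (0 : C) ∈ T) {l : ℝ} (hl : 0 < l) :
    StrictMonoOn (fun r : ℝ => l * ∏ t ∈ T, max r ‖t‖) (Set.Ici 0) := by
  classical
  intro r hr r' hr' hlt
  have hr : 0 ≤ r := hr
  simp only [← Finset.mul_prod_erase T _ h0, norm_zero]
  rw [max_eq_left hr, max_eq_left (hr.trans hlt.le)]
  have hpos : 0 < ∏ t ∈ T.erase 0, max r ‖t‖ := Finset.prod_pos fun t ht =>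
    lt_max_of_lt_right (norm_pos_iff.mpr (Finset.ne_of_mem_erase ht))
  refine mul_lt_mul_of_pos_left (mul_lt_mul hlt ?_ hpos (hr.trans hlt.le)) hl
  exact Finset.prod_le_prod (fun t _ => le_max_of_le_left hr) fun t _ =>
    max_le_max hlt.le le_rfl

/-- A `q`-polynomial of degree `d` with `q ^ d` given roots is the product over these roots. -/
theorem eval_eq_prod_of_roots {p : Polynomial C} (hp : p ≠ 0) {q : ℕ} (hq : 1 < q) {T : Finset C}
    (hT : T.card = q ^ p.natDegree)
    (hroot : ∀ t ∈ T, ∑ i ∈ Finset.range (p.natDegree + 1), p.coeff i * t ^ q ^ i = 0) (x : C) :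
    ∑ i ∈ Finset.range (p.natDegree + 1), p.coeff i * x ^ q ^ i =
      p.leadingCoeff * ∏ t ∈ T, (x - t) := by
  classical
  set Q : Polynomial C := ∑ i ∈ Finset.range (p.natDegree + 1),
    Polynomial.C (p.coeff i) * Polynomial.X ^ q ^ i with hQ
  have heval : ∀ y, Q.eval y = ∑ i ∈ Finset.range (p.natDegree + 1), p.coeff i * y ^ q ^ i :=
    fun y => by simp [hQ, Polynomial.eval_finsetSum]
  have hcoeff : Q.coeff (q ^ p.natDegree) = p.leadingCoeff := by
    rw [hQ, Polynomial.finsetSum_coeff, Finset.sum_eq_single p.natDegree]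
    · simp
    · intro i _ hi
      rw [Polynomial.coeff_C_mul, Polynomial.coeff_X_pow, if_neg, mul_zero]
      exact fun h => hi (Nat.pow_right_injective hq h.symm)
    · simp
  have hne : Q.coeff (q ^ p.natDegree) ≠ 0 := by
    rw [hcoeff]; exact Polynomial.leadingCoeff_ne_zero.mpr hp
  have hQ0 : Q ≠ 0 := by
    intro h
    rw [h, Polynomial.coeff_zero] at hne
    exact hne rfl
  have hdeg : Q.natDegree = q ^ p.natDegree := by
    refine le_antisymm (Polynomial.natDegree_sum_le_of_forall_le _ _ fun i hi => ?_)
      (Polynomial.le_natDegree_of_ne_zero hne)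
    exact (Polynomial.natDegree_C_mul_X_pow_le _ _).trans
      (Nat.pow_le_pow_right hq.le (Nat.lt_succ_iff.mp (Finset.mem_range.mp hi)))
  have hle : T.val ≤ Q.roots := by
    rw [Multiset.le_iff_subset T.nodup]
    exact fun t ht => (Polynomial.mem_roots hQ0).mpr ((heval t).trans (hroot t ht))
  have heq : T.val = Q.roots := Multiset.eq_of_le_of_card_le hle
    ((Polynomial.card_roots' Q).trans (by rw [hdeg, ← hT]; rfl))
  have hprod := Polynomial.C_leadingCoeff_mul_prod_multiset_X_sub_C (p := Q)
    (by rw [← heq, hdeg, ← hT]; rfl)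
  rw [← heval, ← hprod, ← heq, Polynomial.leadingCoeff, hdeg, hcoeff, Polynomial.eval_mul,
    Polynomial.eval_C]
  congr 1
  exact (Polynomial.eval_prod T (fun t => Polynomial.X - Polynomial.C t) x).trans (by simp)

end RootProduct

variable {F K : Type*} [Field F] [Finite F] [Field K] [Algebra F K]

namespace DrinfeldModule

variable {P : RationalPoint F K}

section AnyRank

variable {r : ℕ} {φ : DrinfeldModule P r}

/-- Special functions are the elements whose map on the dual is `A`-equivariant. -/
theorem mem_specialFunctions_iff {ω : CompletedTensor F P.Cinf P.A} :
    ω ∈ φ.specialFunctions ↔ ∀ (a : P.A) (χ : Module.Dual F P.A),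
      dualEval ω (χ ∘ₗ LinearMap.mulLeft F a) = φ.hom a (dualEval ω χ) := by
  refine forall_congr' fun a => ⟨fun h χ => ?_, fun h => completedTensor_ext fun χ => ?_⟩
  · have := congrArg (completedContract χ) h
    rw [completedContract_completedMapLeft, completedContract_smul] at this
    exact this.symm
  · rw [completedContract_completedMapLeft, completedContract_smul]
    exact (h χ).symm

theorem exists_comp_mulLeft_eq {a : P.A} (ha : a ≠ 0) (ψ : Module.Dual F P.A) :
    ∃ χ : Module.Dual F P.A, χ ∘ₗ LinearMap.mulLeft F a = ψ :=
  LinearMap.dualMap_surjective_of_injective (f := LinearMap.mulLeft F a)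
    (mul_right_injective₀ ha) ψ

/-- A special function vanishing on the `t`-torsion is divisible by `t`. -/
theorem exists_smul_eq {ω : CompletedTensor F P.Cinf P.A} (hω : ω ∈ φ.specialFunctions) {t : P.A}
    (ht : t ≠ 0)
    (h : ∀ χ : Module.Dual F P.A, χ ∘ₗ LinearMap.mulLeft F t = 0 → dualEval ω χ = 0) :
    ∃ η ∈ φ.specialFunctions, t • η = ω := by
  obtain ⟨π, hπ⟩ := (LinearMap.mulLeft F t).exists_leftInverse_of_injective
    (LinearMap.ker_eq_bot.mpr (mul_right_injective₀ ht))
  -- For a linear retraction `π` of multiplication by `t`, the form `χ ∘ t ∘ π - χ` vanishes on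
  -- `tA`, so it is `t`-torsion and `ω` kills it.
  have hdiv : t • completedMapRight π ω = ω := completedTensor_ext fun χ => by
    rw [completedContract_smul, completedContract_completedMapRight, ← sub_eq_zero,
      ← dualEval_apply, ← dualEval_apply, ← map_sub]
    refine h _ ?_
    ext u
    have : π (t * u) = u := LinearMap.congr_fun hπ u
    simp [this]
  refine ⟨_, mem_specialFunctions_iff.mpr fun a χ => ?_, hdiv⟩
  obtain ⟨ψ, rfl⟩ := exists_comp_mulLeft_eq ht χ
  have hsm : ∀ ψ : Module.Dual F P.A,
      dualEval (completedMapRight π ω) (ψ ∘ₗ LinearMap.mulLeft F t) = dualEval ω ψ := fun ψ => by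
    rw [dualEval_apply, ← completedContract_smul, hdiv, dualEval_apply]
  have hcomm : (ψ ∘ₗ LinearMap.mulLeft F t) ∘ₗ LinearMap.mulLeft F a =
      (ψ ∘ₗ LinearMap.mulLeft F a) ∘ₗ LinearMap.mulLeft F t := by
    ext u; simp [mul_left_comm]
  rw [hcomm, hsm, hsm]
  exact mem_specialFunctions_iff.mp hω a ψ

/-- The annihilator of the kernel of a special function. -/
def kerAnnihilator {ω : CompletedTensor F P.Cinf P.A} (hω : ω ∈ φ.specialFunctions) :
    Ideal P.A where
  carrier := {v | ∀ χ : Module.Dual F P.A, dualEval ω χ = 0 → χ v = 0}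
  zero_mem' χ _ := map_zero χ
  add_mem' hv hw χ hχ := by rw [map_add, hv χ hχ, hw χ hχ, add_zero]
  smul_mem' a v hv χ hχ := hv (χ ∘ₗ LinearMap.mulLeft F a) (by
    rw [mem_specialFunctions_iff.mp hω, hχ, map_zero])

/-- The kernel of `ω` is closed, hence equal to its double annihilator. -/
theorem dualEval_eq_zero_of_kerAnnihilator {ω : CompletedTensor F P.Cinf P.A}
    (hω : ω ∈ φ.specialFunctions) {χ : Module.Dual F P.A}
    (hχ : ∀ v ∈ kerAnnihilator hω, χ v = 0) : dualEval ω χ = 0 := by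
  by_contra h
  have hpos : 0 < ‖dualEval ω χ‖ := norm_pos_iff.mpr h
  obtain ⟨v, hv, hv'⟩ := exists_separating ω (half_pos hpos) (half_lt_self hpos)
  refine hv (hχ v fun ψ hψ => hv' ψ ?_)
  rw [hψ, norm_zero]
  exact (half_pos hpos).le

/-- A generator of a free module of special functions is injective on the dual of `A`. -/
theorem injective_of_generator [IsDedekindDomain P.A] {ω : CompletedTensor F P.Cinf P.A}
    (hω : ω ∈ φ.specialFunctions) (htf : ∀ a : P.A, a • ω = 0 → a = 0)
    (hgen : ∀ η ∈ φ.specialFunctions, ∃ a : P.A, η = a • ω) :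
    Function.Injective (dualEval ω) := by
  by_cases h1 : kerAnnihilator hω = ⊤
  · refine (injective_iff_map_eq_zero _).mpr fun χ hχ => LinearMap.ext fun v => ?_
    have hv : v ∈ kerAnnihilator hω := h1 ▸ Submodule.mem_top
    exact hv χ hχ
  exfalso
  have h0 : kerAnnihilator hω ≠ ⊥ := fun h0 => by
    have hz : ω = 0 := completedTensor_ext fun χ => by
      rw [completedContract_zero]
      refine dualEval_eq_zero_of_kerAnnihilator hω fun v hv => ?_
      rw [h0] at hv
      rw [(Submodule.mem_bot _).mp hv, map_zero]
    exact one_ne_zero (htf 1 (by rw [hz, smul_zero]))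
  obtain ⟨s, t, ht, hdvd, hndvd⟩ := exists_mul_dvd_not_dvd h0 h1
  obtain ⟨η, hη, hηs⟩ := exists_smul_eq (φ.specialFunctions.smul_mem s hω) ht fun χ hχ => by
    rw [dualEval_apply, completedContract_smul]
    refine dualEval_eq_zero_of_kerAnnihilator hω fun v hv => ?_
    obtain ⟨u, hu⟩ := hdvd v hv
    rw [LinearMap.comp_apply, LinearMap.mulLeft_apply, hu]
    exact LinearMap.congr_fun hχ u
  obtain ⟨a, rfl⟩ := hgen η hη
  refine hndvd ⟨a, ?_⟩
  rw [← sub_eq_zero]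
  refine htf _ ?_
  rw [sub_smul, mul_smul, hηs, sub_self]

end AnyRank

variable [IsCurveFunctionField F K] {φ : DrinfeldModule P 1}

/-- In rank one, the torsion of `φ` is the image of the torsion of the dual of `A`. -/
theorem exists_hom_eq_prod {ω : CompletedTensor F P.Cinf P.A} (hω : ω ∈ φ.specialFunctions)
    (hinj : Function.Injective (dualEval ω)) {a : P.A} (ha : a ≠ 0) :
    ∃ (T : Finset P.Cinf) (l : P.Cinf), l ≠ 0 ∧ (∀ x, φ.hom a x = l * ∏ t ∈ T, (x - t)) ∧
      ∀ t ∈ T, ∃ κ : Module.Dual F P.A, κ ∘ₗ LinearMap.mulLeft F a = 0 ∧ dualEval ω κ = t := by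
  classical
  have := Fintype.ofFinite F
  obtain ⟨p, hdeg, hp0, hp⟩ := φ.exists_poly a ha
  obtain ⟨g, hg, hga⟩ := RationalPoint.exists_injective_torsion ha
  have hpne : p ≠ 0 := by
    rintro rfl
    rw [Polynomial.coeff_zero] at hp0
    exact ha (Subtype.ext ((map_eq_zero P.toCinf).mp hp0.symm))
  let T : Finset P.Cinf := Finset.univ.image (dualEval ω ∘ g)
  -- Rank one enters here: the torsion of the dual gives `q ^ deg a` distinct roots, as many as the
  -- degree of `φ_a` as a polynomial in `x`.
  have hcard : T.card = Nat.card F ^ p.natDegree := by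
    rw [Finset.card_image_of_injective _ (hinj.comp hg), Finset.card_univ, Fintype.card_fun,
      Fintype.card_fin, Nat.card_eq_fintype_card]
    congr 1
    simp only [Nat.cast_one, one_mul] at hdeg
    omega
  have hmem : ∀ t ∈ T, ∃ κ : Module.Dual F P.A,
      κ ∘ₗ LinearMap.mulLeft F a = 0 ∧ dualEval ω κ = t := fun t ht => by
    obtain ⟨c, -, hc⟩ := Finset.mem_image.mp ht
    exact ⟨g c, hga c, hc⟩
  refine ⟨T, p.leadingCoeff, Polynomial.leadingCoeff_ne_zero.mpr hpne, fun x => ?_, hmem⟩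
  rw [hp]
  refine eval_eq_prod_of_roots hpne Finite.one_lt_card hcard (fun t ht => ?_) x
  obtain ⟨κ, hκ, rfl⟩ := hmem t ht
  rw [← hp, ← mem_specialFunctions_iff.mp hω, hκ, map_zero]

/-- The norm of `φ_a` at a point closest to `0` modulo torsion depends on the norm only. -/
theorem exists_strictMonoOn_norm {ω : CompletedTensor F P.Cinf P.A} (hω : ω ∈ φ.specialFunctions)
    (hinj : Function.Injective (dualEval ω)) {a : P.A} (ha : a ≠ 0) :
    ∃ Φ : ℝ → ℝ, StrictMonoOn Φ (Set.Ici 0) ∧ ∀ χ : Module.Dual F P.A,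
      ∃ χ' : Module.Dual F P.A, χ' ∘ₗ LinearMap.mulLeft F a = χ ∘ₗ LinearMap.mulLeft F a ∧
        ‖dualEval ω χ'‖ ≤ ‖dualEval ω χ‖ ∧
        ‖dualEval ω (χ ∘ₗ LinearMap.mulLeft F a)‖ = Φ ‖dualEval ω χ'‖ := by
  obtain ⟨T, l, hl, hprod, hT⟩ := exists_hom_eq_prod hω hinj ha
  have hmem : ∀ x, x ∈ T ↔ φ.hom a x = 0 := fun x => by
    rw [hprod, mul_eq_zero, or_iff_right hl, Finset.prod_eq_zero_iff]
    exact ⟨fun h => ⟨x, h, sub_self x⟩, fun ⟨t, ht, h⟩ => sub_eq_zero.mp h ▸ ht⟩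
  have h0 : (0 : P.Cinf) ∈ T := (hmem 0).mpr (map_zero _)
  refine ⟨_, strictMonoOn_prod_max h0 (norm_pos_iff.mpr hl), fun χ => ?_⟩
  -- After translating by the nearest root, 0 is a nearest root, so by the ultrametric inequality
  -- each factor `x - t` has norm `max ‖x‖ ‖t‖`.
  obtain ⟨t₀, ht₀, hmin⟩ := T.exists_min_image (fun t => ‖dualEval ω χ - t‖) ⟨0, h0⟩
  obtain ⟨κ, hκ, hκt⟩ := hT t₀ ht₀
  have hx : dualEval ω (χ - κ) = dualEval ω χ - t₀ := by rw [map_sub, hκt]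
  have hcomp : (χ - κ) ∘ₗ LinearMap.mulLeft F a = χ ∘ₗ LinearMap.mulLeft F a := by
    rw [LinearMap.sub_comp, hκ, sub_zero]
  refine ⟨χ - κ, hcomp, ?_, ?_⟩
  · rw [hx]
    simpa using hmin 0 h0
  · rw [← hcomp, mem_specialFunctions_iff.mp hω, hprod, norm_mul, norm_prod]
    congr 1
    refine Finset.prod_congr rfl fun t ht => norm_sub_eq_max_of_le ?_
    rw [hx, sub_sub]
    refine hmin _ ((hmem _).mpr ?_)
    rw [map_add, (hmem _).mp ht₀, (hmem _).mp ht, add_zero]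

theorem minNorm_mul_lt_iff {ω : CompletedTensor F P.Cinf P.A} (hω : ω ∈ φ.specialFunctions)
    (hinj : Function.Injective (dualEval ω)) {a v w : P.A} (ha : a ≠ 0) (hv : v ≠ 0) (hw : w ≠ 0) :
    minNorm ω (a * v) < minNorm ω (a * w) ↔ minNorm ω v < minNorm ω w := by
  obtain ⟨Φ, hΦ, h⟩ := exists_strictMonoOn_norm hω hinj ha
  -- Forms nonzero at `v` are exactly the `χ ∘ a` with `χ` nonzero at `a * v`, and `χ` may be
  -- replaced by its best torsion translate.
  have key : ∀ v : P.A, v ≠ 0 → minNorm ω v = Φ (minNorm ω (a * v)) := fun v hv => by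
    refine le_antisymm ?_ ?_
    · obtain ⟨χ, hχ, hN⟩ := exists_norm_eq_minNorm ω (mul_ne_zero ha hv)
      obtain ⟨χ', -, hle, heq⟩ := h χ
      rw [← hN]
      refine (minNorm_le ω (χ := χ ∘ₗ LinearMap.mulLeft F a) hχ).trans ?_
      rw [heq]
      exact hΦ.monotoneOn (norm_nonneg _) (norm_nonneg _) hle
    · obtain ⟨ψ, hψ, hN⟩ := exists_norm_eq_minNorm ω hv
      obtain ⟨χ, rfl⟩ := exists_comp_mulLeft_eq ha ψ
      obtain ⟨χ', hχ', -, heq⟩ := h χ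
      rw [← hN, heq]
      refine hΦ.monotoneOn (minNorm_pos hinj (mul_ne_zero ha hv)).le (norm_nonneg _)
        (minNorm_le ω ?_)
      rw [← hχ'] at hψ
      exact hψ
  rw [key v hv, key w hw]
  exact (hΦ.lt_iff_lt (minNorm_pos hinj (mul_ne_zero ha hv)).le
    (minNorm_pos hinj (mul_ne_zero ha hw)).le).symm

end DrinfeldModule

end Torsion

/-! ### Minimal norms decrease strictly with the degree -/

section Monotonicity

variable {F K : Type*} [Field F] [Finite F] [Field K] [Algebra F K]

namespace RationalPoint

variable {P : RationalPoint F K} {N : P.A → ℝ}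

/-- The subring of fractions `v / w` with `N w ≤ N v`. -/
def fractionSubring (hadd : ∀ v w, v + w ≠ 0 → min (N v) (N w) ≤ N (v + w))
    (hneg : ∀ v, N (-v) = N v)
    (hmul : ∀ a v w, a ≠ 0 → v ≠ 0 → w ≠ 0 → N v ≤ N w → N (a * v) ≤ N (a * w)) :
    Subring K where
  carrier := {x | ∃ v w : P.A, w ≠ 0 ∧ x = v / w ∧ (v ≠ 0 → N w ≤ N v)}
  zero_mem' := ⟨0, 1, one_ne_zero, by simp, fun h => absurd rfl h⟩
  one_mem' := ⟨1, 1, one_ne_zero, by simp, fun _ => le_rfl⟩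
  neg_mem' := by
    rintro _ ⟨v, w, hw, rfl, h⟩
    refine ⟨-v, w, hw, by push_cast; ring, fun hv => ?_⟩
    rw [hneg]
    exact h fun h0 => hv (by rw [h0, neg_zero])
  mul_mem' := by
    rintro _ _ ⟨v, w, hw, rfl, h⟩ ⟨v', w', hw', rfl, h'⟩
    refine ⟨v * v', w * w', mul_ne_zero hw hw', by push_cast; rw [div_mul_div_comm], fun h0 => ?_⟩
    have hv := left_ne_zero_of_mul h0
    have hv' := right_ne_zero_of_mul h0
    refine (hmul w w' v' hw hw' hv' (h' hv')).trans ?_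
    rw [mul_comm w, mul_comm v]
    exact hmul v' w v hv' hw hv (h hv)
  add_mem' := by
    rintro _ _ ⟨v, w, hw, rfl, h⟩ ⟨v', w', hw', rfl, h'⟩
    have hwK : (w : K) ≠ 0 := fun h => hw (Subtype.ext h)
    have hwK' : (w' : K) ≠ 0 := fun h => hw' (Subtype.ext h)
    refine ⟨v * w' + w * v', w * w', mul_ne_zero hw hw', by
      push_cast; rw [div_add_div _ _ hwK hwK'], fun h0 => ?_⟩
    have h1 : v ≠ 0 → N (w * w') ≤ N (v * w') := fun hv => by
      rw [mul_comm w, mul_comm v]; exact hmul w' w v hw' hw hv (h hv)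
    have h2 : v' ≠ 0 → N (w * w') ≤ N (w * v') := fun hv' => hmul w w' v' hw hw' hv' (h' hv')
    rcases eq_or_ne v 0 with rfl | hv
    · rw [zero_mul, zero_add] at h0 ⊢
      exact h2 (right_ne_zero_of_mul h0)
    rcases eq_or_ne v' 0 with rfl | hv'
    · rw [mul_zero, add_zero]
      exact h1 hv
    exact (le_min (h1 hv) (h2 hv')).trans (hadd _ _ h0)

/-- A function on `A` that behaves like the inverse of an absolute value with finite balls is
strictly decreasing in the degree: only the point `∞` can be the centre of such an absolute
value. -/
theorem lt_of_deg_lt (hadd : ∀ v w, v + w ≠ 0 → min (N v) (N w) ≤ N (v + w))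
    (hneg : ∀ v, N (-v) = N v)
    (hmul : ∀ a v w, a ≠ 0 → v ≠ 0 → w ≠ 0 → (N (a * v) < N (a * w) ↔ N v < N w))
    (hfin : {v : P.A | v ≠ 0 ∧ N 1 ≤ N v}.Finite)
    {v w : P.A} (hv : v ≠ 0) (hw : w ≠ 0) (hdeg : P.deg v < P.deg w)
    {t : P.A} (ht : 0 < P.deg t) : N w < N v := by
  by_contra hlt
  have hle := not_lt.mp hlt
  have hmul' : ∀ a v w, a ≠ 0 → v ≠ 0 → w ≠ 0 → N v ≤ N w → N (a * v) ≤ N (a * w) :=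
    fun a v w ha hv hw h => not_lt.mp fun h' => absurd ((hmul a w v ha hw hv).mp h') (not_lt.mpr h)
  have ht0 : t ≠ 0 := by rintro rfl; simp [deg] at ht
  -- Otherwise all powers of `t`, which are distinct, would lie in the finite set `hfin`.
  have hN : N t < N 1 := by
    by_contra hge
    have hpow : ∀ n : ℕ, N 1 ≤ N (t ^ n) := fun n => by
      induction n with
      | zero => rw [pow_zero]
      | succ n ih =>
        refine ih.trans ?_
        have := hmul' (t ^ n) 1 t (pow_ne_zero n ht0) one_ne_zero ht0 (not_lt.mp hge)
        rwa [mul_one, ← pow_succ] at this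
    have hmem : ∀ n : ℕ, t ^ n ∈ {v : P.A | v ≠ 0 ∧ N 1 ≤ N v} := fun n =>
      ⟨pow_ne_zero n ht0, hpow n⟩
    refine Set.infinite_of_injective_forall_mem (fun m n hmn => ?_) hmem hfin
    have := congrArg P.deg hmn
    simp only [deg_pow ht0] at this
    exact_mod_cast mul_right_cancel₀ ht.ne' this
  let S : Subring K := fractionSubring hadd hneg hmul'
  let I : Ideal S :=
    { carrier := {x | ∃ v w : P.A, w ≠ 0 ∧ (x : K) = v / w ∧ (v ≠ 0 → N w < N v)}
      zero_mem' := ⟨0, 1, one_ne_zero, by simp, fun h => absurd rfl h⟩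
      add_mem' := by
        rintro ⟨_, _⟩ ⟨_, _⟩ ⟨v, w, hw, rfl, h⟩ ⟨v', w', hw', rfl, h'⟩
        have hwK : (w : K) ≠ 0 := fun h => hw (Subtype.ext h)
        have hwK' : (w' : K) ≠ 0 := fun h => hw' (Subtype.ext h)
        refine ⟨v * w' + w * v', w * w', mul_ne_zero hw hw', by
          push_cast; rw [div_add_div _ _ hwK hwK'], fun h0 => ?_⟩
        have h1 : v ≠ 0 → N (w * w') < N (v * w') := fun hv => by
          rw [mul_comm w, mul_comm v]; exact (hmul w' w v hw' hw hv).mpr (h hv)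
        have h2 : v' ≠ 0 → N (w * w') < N (w * v') := fun hv' =>
          (hmul w w' v' hw hw' hv').mpr (h' hv')
        rcases eq_or_ne v 0 with rfl | hv
        · rw [zero_mul, zero_add] at h0 ⊢
          exact h2 (right_ne_zero_of_mul h0)
        rcases eq_or_ne v' 0 with rfl | hv'
        · rw [mul_zero, add_zero]
          exact h1 hv
        exact (lt_min (h1 hv) (h2 hv')).trans_le (hadd _ _ h0)
      smul_mem' := by
        rintro ⟨_, v, w, hw, rfl, h⟩ ⟨_, _⟩ ⟨v', w', hw', rfl, h'⟩
        refine ⟨v * v', w * w', mul_ne_zero hw hw', by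
          push_cast; rw [smul_eq_mul]; exact div_mul_div_comm _ _ _ _, fun h0 => ?_⟩
        have hv := left_ne_zero_of_mul h0
        have hv' := right_ne_zero_of_mul h0
        refine ((hmul w w' v' hw hw' hv').mpr (h' hv')).trans_le ?_
        rw [mul_comm w, mul_comm v]
        exact hmul' v' w v hv' hw hv (h hv) }
  have hI : I ≠ ⊤ := fun htop => by
    obtain ⟨v, w, hw, h1, h⟩ := (Ideal.eq_top_iff_one I).mp htop
    have hwK : (w : K) ≠ 0 := fun h => hw (Subtype.ext h)
    have hvw : v = w := Subtype.ext ((div_eq_one_iff_eq hwK).mp h1.symm)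
    exact lt_irrefl _ (hvw ▸ h (hvw ▸ hw))
  -- A valuation ring `B` containing `S` and having `I` among its nonunits exists because `I` is
  -- proper. It omits `t`, since `1 / t` is in `I`; as `t` is regular away from `∞`, `B` is the
  -- valuation ring of `∞`.
  obtain ⟨B, hSB, hIB⟩ := Ideal.image_subset_nonunits_valuationSubring I hI
  have htI : ((t : K)⁻¹) ∈ B.nonunits := by
    have hmem : (t : K)⁻¹ ∈ S := ⟨1, t, ht0, by simp, fun _ => hN.le⟩
    exact hIB ⟨⟨_, hmem⟩, ⟨1, t, ht0, by simp, fun _ => hN⟩, rfl⟩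
  have htB : (t : K) ∉ B := (B.inv_mem_nonunits_iff.mp htI).resolve_left
    fun h => ht0 (Subtype.ext h)
  have hB : B = P.val.valuationSubring := by
    by_contra hB
    exact htB (t.2 B hB)
  have hmem : (w : K) / v ∈ B := hSB ⟨w, v, hv, rfl, fun _ => hle⟩
  rw [hB] at hmem
  have h1 : P.val ((w : K) / v) ≤ 1 := hmem
  rw [map_div₀, div_le_one₀ (zero_lt_iff.mpr (val_ne_zero hv)), ← deg_le_deg_iff hw hv] at h1
  omega

/-- Basis elements of distinct degrees cannot cancel in leading order. -/
theorem deg_le_deg_of_coord_ne_zero {b : Module.Basis ℕ F P.A}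
    (hb : StrictMono fun i => P.deg (b i)) {v : P.A} {j : ℕ} (hj : b.coord j v ≠ 0) :
    P.deg (b j) ≤ P.deg v := by
  classical
  have hs : (b.repr v).support.Nonempty := ⟨j, Finsupp.mem_support_iff.mpr hj⟩
  have hval : ∀ i ∈ (b.repr v).support, P.val ((b.repr v i • b i : P.A) : K) = P.val (b i : K) :=
    fun i hi => P.val_smul (Finsupp.mem_support_iff.mp hi) _
  obtain ⟨i, hi, hsum, hmax⟩ := valuation_sum_eq_of_injOn P.val hs
    (f := fun i => ((b.repr v i • b i : P.A) : K))
    (fun i hi => by rw [hval i hi]; exact val_ne_zero (b.ne_zero i))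
    (fun i hi k hk hik => by
      simp only [hval i hi, hval k hk] at hik
      exact hb.injective (congrArg WithZero.log hik))
  have hv : ∑ i ∈ (b.repr v).support, ((b.repr v i • b i : P.A) : K) = (v : K) := by
    rw [← AddSubmonoidClass.coe_finsetSum]
    exact congrArg Subtype.val (b.linearCombination_repr v)
  have hv0 : v ≠ 0 := by rintro rfl; simp at hj
  have h := hmax j (Finsupp.mem_support_iff.mpr hj)
  rw [← hsum, hv, hval j (Finsupp.mem_support_iff.mpr hj)] at h
  exact (deg_le_deg_iff (b.ne_zero j) hv0).mpr h

end RationalPoint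

namespace DrinfeldModule

variable {P : RationalPoint F K} [IsCurveFunctionField F K] {φ : DrinfeldModule P 1}

theorem minNorm_lt_of_deg_lt {ω : CompletedTensor F P.Cinf P.A} (hω : ω ∈ φ.specialFunctions)
    (hinj : Function.Injective (dualEval ω)) {v w : P.A} (hv : v ≠ 0) (hw : w ≠ 0)
    (h : P.deg v < P.deg w) : minNorm ω w < minNorm ω v :=
  RationalPoint.lt_of_deg_lt (fun _ _ => min_minNorm_le_add ω) (minNorm_neg ω)
    (fun _ _ _ => minNorm_mul_lt_iff hω hinj) (finite_le_minNorm ω (minNorm_pos hinj one_ne_zero))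
    hv hw h ((RationalPoint.deg_nonneg hv).trans_lt h)

theorem minNorm_le_of_deg_le {ω : CompletedTensor F P.Cinf P.A} (hω : ω ∈ φ.specialFunctions)
    (hinj : Function.Injective (dualEval ω)) {v w : P.A} (hv : v ≠ 0) (hw : w ≠ 0)
    (h : P.deg v ≤ P.deg w) : minNorm ω w ≤ minNorm ω v := by
  rcases h.lt_or_eq with h | h
  · exact (minNorm_lt_of_deg_lt hω hinj hv hw h).le
  have hval : P.val (v : K) = P.val (w : K) := by
    rw [RationalPoint.val_eq_exp_deg hv, RationalPoint.val_eq_exp_deg hw, h]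
  -- In equal degrees, `v` is `c • w` plus a term of lower degree, whose minimal norm is larger.
  obtain ⟨c, hc, hlt⟩ := RationalPoint.exists_val_sub_smul_lt hw hval
  rcases eq_or_ne (v - c • w) 0 with h0 | h0
  · rw [sub_eq_zero.mp h0, minNorm_smul ω hc]
  · have h1 := minNorm_lt_of_deg_lt hω hinj h0 hw ((RationalPoint.deg_lt_deg_iff h0 hw).mpr hlt)
    have h2 := min_minNorm_le_add ω (v := v - c • w) (w := c • w) (by rwa [sub_add_cancel])
    rwa [sub_add_cancel, minNorm_smul ω hc, min_eq_right h1.le] at h2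

/-- Linear forms vanishing on all functions of degree less than `deg w` have small image. -/
theorem norm_dualEval_le_minNorm {ω : CompletedTensor F P.Cinf P.A} (hω : ω ∈ φ.specialFunctions)
    (hinj : Function.Injective (dualEval ω)) {w : P.A} (hw : w ≠ 0) {χ : Module.Dual F P.A}
    (hχ : ∀ v : P.A, v ≠ 0 → P.deg v < P.deg w → χ v = 0) :
    ‖dualEval ω χ‖ ≤ minNorm ω w := by
  by_contra h
  -- A separating `v` with `deg v ≥ deg w` is impossible: a form attaining the minimum at `v` lies
  -- in the ball of radius `minNorm ω w` but is nonzero at `v`.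
  obtain ⟨v, hv, hsep⟩ := exists_separating ω (minNorm_pos hinj hw) (not_le.mp h)
  have hv0 : v ≠ 0 := by rintro rfl; exact hv (map_zero χ)
  refine hv (hχ v hv0 ?_)
  by_contra hdeg
  obtain ⟨ψ, hψ, hN⟩ := exists_norm_eq_minNorm ω hv0
  exact hψ (hsep ψ (hN.trans_le (minNorm_le_of_deg_le hω hinj hw hv0 (not_lt.mp hdeg))))

theorem strictAnti_norm_coord {ω : CompletedTensor F P.Cinf P.A} (hω : ω ∈ φ.specialFunctions)
    (hinj : Function.Injective (dualEval ω)) {b : Module.Basis ℕ F P.A}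
    (hb : StrictMono fun i => P.deg (b i)) :
    StrictAnti fun i => ‖completedContract (b.coord i) ω‖ := by
  intro i j hij
  calc ‖completedContract (b.coord j) ω‖ ≤ minNorm ω (b j) :=
        norm_dualEval_le_minNorm hω hinj (b.ne_zero j) fun v _ hdeg => by
          by_contra hne
          exact absurd (RationalPoint.deg_le_deg_of_coord_ne_zero hb hne) (not_le.mpr hdeg)
    _ < minNorm ω (b i) := minNorm_lt_of_deg_lt hω hinj (b.ne_zero i) (b.ne_zero j) (hb hij)
    _ ≤ ‖completedContract (b.coord i) ω‖ := minNorm_le ω (χ := b.coord i) (by simp)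

theorem exists_dual_one : ∃ χ : Module.Dual F P.A, χ 1 = 1 := by
  obtain ⟨f, hf⟩ := Module.Projective.exists_dual_ne_zero F (one_ne_zero (α := P.A))
  exact ⟨(f 1)⁻¹ • f, inv_mul_cancel₀ hf⟩

theorem isUnit_of_injective {ω : CompletedTensor F P.Cinf P.A} (hω : ω ∈ φ.specialFunctions)
    (hinj : Function.Injective (dualEval ω)) {a : P.A} (ha : 0 < P.deg a) : IsUnit ω := by
  classical
  -- For `w` of least positive degree, the functions of smaller degree are the constants, so a form
  -- killing 1 has image of norm at most `minNorm ω w < minNorm ω 1`.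
  have hex : ∃ n : ℕ, 0 < n ∧ ∃ w : P.A, P.deg w = n :=
    ⟨(P.deg a).toNat, by omega, a, (Int.toNat_of_nonneg ha.le).symm⟩
  obtain ⟨hpos, w, hwn⟩ := Nat.find_spec hex
  have hw : w ≠ 0 := by
    intro h
    have : P.deg w = 0 := by rw [h]; simp [RationalPoint.deg]
    omega
  obtain ⟨χ₀, h₀⟩ := exists_dual_one (P := P)
  have hdeg1 : P.deg 1 = 0 := by simp [RationalPoint.deg]
  refine isUnit_of_dominant h₀ (r := minNorm ω w) ?_ fun χ hχ =>
    norm_dualEval_le_minNorm hω hinj hw fun v hv hdeg => ?_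
  · refine (minNorm_lt_of_deg_lt hω hinj one_ne_zero hw (by omega)).trans_le
      (minNorm_le ω (by rw [h₀]; exact one_ne_zero))
  · have hv0 : P.deg v = 0 := by
      have h1 := RationalPoint.deg_nonneg hv
      by_contra hne
      have h2 := Int.toNat_of_nonneg h1
      have := Nat.find_min' hex ⟨by omega, v, h2.symm⟩
      omega
    obtain ⟨c, rfl⟩ := RationalPoint.exists_eq_algebraMap_of_deg_eq_zero hv hv0
    rw [Algebra.algebraMap_eq_smul_one, map_smul, hχ, smul_zero]

/-- The case without functions of positive degree. -/
theorem isUnit_of_forall_deg_le {ω : CompletedTensor F P.Cinf P.A} (hω : ω ≠ 0)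
    (hA : ∀ a : P.A, P.deg a ≤ 0) : IsUnit ω := by
  obtain ⟨χ₀, h₀⟩ := exists_dual_one (P := P)
  have hzero : ∀ χ : Module.Dual F P.A, χ 1 = 0 → χ = 0 := fun χ hχ => LinearMap.ext fun v => by
    rcases eq_or_ne v 0 with rfl | hv
    · rw [map_zero, map_zero]
    obtain ⟨c, rfl⟩ := RationalPoint.exists_eq_algebraMap_of_deg_eq_zero hv
      (le_antisymm (hA v) (RationalPoint.deg_nonneg hv))
    rw [Algebra.algebraMap_eq_smul_one, map_smul, hχ, smul_zero, LinearMap.zero_apply]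
  refine isUnit_of_dominant h₀ (r := 0) ?_ fun χ hχ => by rw [hzero χ hχ, map_zero, norm_zero]
  rw [norm_pos_iff]
  refine fun h => hω (completedTensor_ext fun χ => ?_)
  have : χ - χ 1 • χ₀ = 0 := hzero _ (by simp [h₀])
  rw [completedContract_zero, ← dualEval_apply, sub_eq_zero.mp this, map_smul, h, smul_zero]

end DrinfeldModule

end Monotonicity

end SpecialFunctions

end

open SpecialFunctions in
theorem mainTheorem5 {F K : Type*} [Field F] [Finite F] [Field K] [Algebra F K]
    [SpecialFunctions.IsCurveFunctionField F K] (P : SpecialFunctions.RationalPoint F K)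
    (φ : SpecialFunctions.DrinfeldModule P 1)
    (hφ : Nonempty (φ.specialFunctions ≃ₗ[P.A] P.A)) :
    ∃ ω ∈ φ.specialFunctions, IsUnit ω ∧
      ∀ b : Module.Basis ℕ F P.A, StrictMono (fun i => P.deg (b i)) →
        StrictAnti (fun i => ‖SpecialFunctions.completedContract (b.coord i) ω‖) := by
  obtain ⟨e⟩ := hφ
  have htf : ∀ a : P.A, a • (e.symm 1 : CompletedTensor F P.Cinf P.A) = 0 → a = 0 := fun a ha => by
    have h1 : a • e.symm 1 = 0 := Subtype.ext ha
    have h2 := congrArg e h1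
    simpa using h2
  refine ⟨e.symm 1, (e.symm 1).2, ?_⟩
  -- This split avoids proving that nonconstant functions exist. Without them `A` is `F`, and no
  -- basis indexed by `ℕ` has strictly increasing degrees.
  by_cases hA : ∃ a : P.A, 0 < P.deg a
  · obtain ⟨a, ha⟩ := hA
    have := RationalPoint.isDedekindDomain_A ha
    have hinj := DrinfeldModule.injective_of_generator (e.symm 1).2 htf fun η hη => by
      refine ⟨e ⟨η, hη⟩, ?_⟩
      have h : e ⟨η, hη⟩ • e.symm 1 = ⟨η, hη⟩ := by
        rw [← map_smul, smul_eq_mul, mul_one, e.symm_apply_apply]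
      exact (congrArg Subtype.val h).symm
    exact ⟨DrinfeldModule.isUnit_of_injective (e.symm 1).2 hinj ha,
      fun b hb => DrinfeldModule.strictAnti_norm_coord (e.symm 1).2 hinj hb⟩
  · have hA' : ∀ a : P.A, P.deg a ≤ 0 := fun a => not_lt.mp fun h => hA ⟨a, h⟩
    refine ⟨DrinfeldModule.isUnit_of_forall_deg_le (fun h0 => ?_) hA', fun b hb => ?_⟩
    · exact one_ne_zero (htf 1 (by rw [h0, smul_zero]))
    · have h1 := hb zero_lt_one
      exact absurd (((RationalPoint.deg_nonneg (b.ne_zero 0)).trans_lt h1).trans_le (hA' _))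
        (lt_irrefl _)
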